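/- **Definitions.** Let $G$ be a finite simple graph with $n\ge 1$ nodes and connected components $G_1,\dots,G_m$ (called the universal tubes of $G$). A *tube* is a nonempty proper subset of the nodes that induces a connected subgraph. Two tubes are *compatible* if one properly contains the other, or if they are disjoint and not joined by an edge. A *tubing* is a set of pairwise compatible tubes that does not contain all of $G_1,\dots,G_m$. The *graph associahedron* $\mathcal KG$ is given by its poset of nonempty faces: the tubings, with $T\preceq T'$ iff $T\supseteq T'$. For a tubing $T$ and $t\in T\cup\{G_1,\dots,G_m\}$, the *core* of $t$ is the graph whose nodes are the nodes of $t$ in no tube $s\in T$ with $s\subsetneq t$; two of them are adjacent if they are adjacent in $G$ or joined by a path through some $s\in T$, $s\subsetneq t$. Let $c_t$ be its number of nodes, and let $k_t$ be its connectivity, i.e. the least number of nodes whose removal leaves a graph that is disconnected or has at most one node (with $k_t-1$ read as $0$ if $c_t=1$). A *palette* is a multiset of $n-1$ colors; it is *full* if its colors are distinct and *monochrome* if they are all equal. A *color template* is a tubing $T$ with a distribution of the palette as follows. Each $t\in T$ gets a color, an ordered list of $k_t-1$ colors (the outer blocks), and an unordered multiset of the remaining $c_t-1-(k_t-1)$ of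 its $c_t$ colors (the inner block). Each $G_i\notin T$ gets the same except for the color of the tube, hence $c_{G_i}-1$ colors. The other $m-1-|T\cap\{G_1,\dots,G_m\}|$ colors form the unordered universal block. The colors of $t$ are partially ordered: the color of $t$, then the outer blocks in order, then the inner block, whose colors are mutually unordered. A template on $T=T'\cup\{t\}$, $t\notin T'$, is *obtained by adding $t$* to a template on $T'$ in the following cases. If $t=G_i$, the color of $G_i$ is taken from the universal block, and everything else is unchanged. If $t$ is not a component, let $t_*$ be the smallest element of $T'\cup\{G_1,\dots,G_m\}$ properly containing $t$; then the colors of $t_*$ are listed in some order that extends their partial order, the first of them go in this order to $t_*$ and the others in this order to $t$, as many to each as prescribed above for $T$ (orders inside the new inner blocks being forgotten), and everything else is unchanged. The *colorful graph associahedron* $\mathcal K^cG$ is the poset of all color templates, with $A\preceq B$ iff $A$ is obtained from $B$ by iteratively adding tubes; its elements are the nonempty faces of a collection of polytopes, one below each template with the empty tubing. Let $G[m]$ be the null graph on $m$ nodes and $\Delta_i$ the $i$-simplex, given by its poset of nonempty faces. Products are direct products of posets of nonempty faces, and isomorphisms are order isomorphisms. **Statement.** Let $G$ be a finite simple graph with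 $n\ge1$ nodes and connected components $G_1,\dots,G_m$, where $|G_i|$ denotes the number of nodes of $G_i$, together with a palette of $n-1$ colors. 1. If the palette is monochrome, then $$\mathcal K^cG\;\cong\;\mathcal KG_1\times\cdots\times\mathcal KG_m\times\Delta_{m-1}.$$ 2. If the palette is full, then $$\mathcal K^cG\;\cong\;\bigsqcup_{(P_1,\dots,P_m,P_0)}\mathcal K^cG_1\times\cdots\times\mathcal K^cG_m\times\mathcal K^cG[m],$$ a disjoint union over the ordered partitions $(P_1,\dots,P_m,P_0)$ of the palette into classes of sizes $|G_1|-1,\dots,|G_m|-1,m-1$, where in the term of $(P_1,\dots,P_m,P_0)$ the factor $\mathcal K^cG_i$ has palette $P_i$ and the factor $\mathcal K^cG[m]$ has palette $P_0$. The number of terms is $$\binom{n-1}{m-1}\prod_{i=1}^m\binom{\,n-m-\sum_{j<i}(|G_j|-1)\,}{|G_i|-1}.$$ The terms are identical copies of one product: each is isomorphic to $\mathcal K^cG_1\times\cdots\times\mathcal K^cG_m\times\mathcal K^cG[m]$ formed with arbitrary full palettes for the factors. Moreover, all members of the collection $\mathcal K^cG$, i.e. the lower sets of the templates with the empty tubing,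 are isomorphic to each other. -/

import Mathlib

namespace ColorfulAssoc

/-! ### Tubes and tubings -/

/-- The universal tubes of `G`: the node sets of its connected components
(for a connected graph, the single set of all nodes). -/
def universalTubes {V : Type*} (G : SimpleGraph V) : Set (Set V) :=
  Set.range fun c : G.ConnectedComponent => c.supp

/-- A tube: a (nonempty) proper set of nodes whose induced subgraph is connected. -/
def IsTube {V : Type*} (G : SimpleGraph V) (t : Set V) : Prop :=
  t ≠ Set.univ ∧ (G.induce t).Connected

/-- Two tubes are compatible if one properly contains the other, or if they are disjoint and
not joined by an edge. -/
def Compatible {V : Type*} (G : SimpleGraph V) (s t : Set V) : Prop :=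
  s ⊂ t ∨ t ⊂ s ∨ (Disjoint s t ∧ ∀ x ∈ s, ∀ y ∈ t, ¬ G.Adj x y)

/-- A tubing: a set of pairwise compatible tubes that does not contain all connected components
(the last condition is automatic if `G` is connected, as `G` itself is not a tube). -/
@[ext]
structure Tubing {V : Type*} (G : SimpleGraph V) where
  tubes : Set (Set V)
  isTube : ∀ t ∈ tubes, IsTube G t
  compatible : tubes.Pairwise (Compatible G)
  not_all : ¬ universalTubes G ⊆ tubes

/-- The classical graph associahedron of `G`, as the poset of its nonempty faces: these are the
tubings, and `T ≤ T'` if `T` is obtained from `T'` by adding tubes. -/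
instance {V : Type*} (G : SimpleGraph V) : PartialOrder (Tubing G) where
  le T T' := T'.tubes ⊆ T.tubes
  le_refl _ := Set.Subset.rfl
  le_trans _ _ _ h h' := Set.Subset.trans h' h
  le_antisymm _ _ h h' := Tubing.ext (Set.Subset.antisymm h' h)

/-! ### Cores and connectivity -/

/-- The nodes of the core of `t` in `T`: the nodes of `t` lying in no tube of `T` strictly inside
`t`.  Here `t` is a tube of `T` or a universal tube. -/
def coreNodes {V : Type*} (T : Set (Set V)) (t : Set V) : Set V :=
  {v | v ∈ t ∧ ∀ s ∈ T, s ⊂ t → v ∉ s}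

/-- The core graph of `t` in `T`.  Two distinct nodes of the core are adjacent if they are adjacent
in `G` or connected by a path through some tube `s ⊂ t` of `T`; as `s` is connected, the latter
means that both nodes have a neighbour in `s`. -/
def coreGraph {V : Type*} (G : SimpleGraph V) (T : Set (Set V)) (t : Set V) :
    SimpleGraph (coreNodes T t) where
  Adj x y := x ≠ y ∧ (G.Adj x y ∨
    ∃ s ∈ T, s ⊂ t ∧ (∃ a ∈ s, G.Adj x a) ∧ (∃ b ∈ s, G.Adj y b))
  symm := ⟨fun _ _ h => ⟨h.1.symm, h.2.imp (fun e => e.symm)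
    fun ⟨s, hs, hst, ha, hb⟩ => ⟨s, hs, hst, hb, ha⟩⟩⟩
  loopless := ⟨fun _ h => h.1 rfl⟩

/-- The (vertex) connectivity of a finite graph: the least number of nodes whose removal leaves a
graph that is disconnected or has at most one node.  In particular the complete graph on `n ≥ 1`
nodes has connectivity `n - 1`. -/
noncomputable def connectivity {W : Type*} (H : SimpleGraph W) : ℕ :=
  sInf {k | ∃ S : Set W, S.ncard = k ∧ (¬ (H.induce Sᶜ).Preconnected ∨ Sᶜ.Subsingleton)}

/-- The number `k - 1` of outer blocks of `t` in `T`, where `k` is the connectivity of the core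
(`0` for a one-node core, which has connectivity `0`). -/
noncomputable def outerCount {V : Type*} (G : SimpleGraph V) (T : Set (Set V)) (t : Set V) : ℕ :=
  connectivity (coreGraph G T t) - 1

/-! ### Color templates -/

/-- The color blocks attached to a tube: a list `ordered` of singleton blocks (the color of the
tube, if it is colored, followed by the outer blocks), and the unordered inner block. -/
@[ext]
structure Blocks (C : Type*) where
  ordered : List C
  inner : Multiset C

/-- All colors occurring in the blocks. -/
def Blocks.colors {C : Type*} (b : Blocks C) : Multiset C := (b.ordered : Multiset C) + b.inner

/-- `w` lists the colors of `b` in an order that preserves the partial order of `b`: first the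
ordered blocks, then the inner block in an arbitrary order. -/
def Blocks.IsLinearization {C : Type*} (b : Blocks C) (w : List C) : Prop :=
  ∃ l : List C, (l : Multiset C) = b.inner ∧ w = b.ordered ++ l

/-- A color template of `G` with color palette `P`: a tubing together with a distribution of the
palette over the tubes of the tubing, the universal tubes, and the universal block.
* A tube of the tubing gets its own color, `outerCount` outer blocks and an inner block, as many
  colors in total as its core has nodes.
* A universal tube that is not in the tubing is not colored, and gets one color less.
* The universal block holds the colors for the universal tubes that can still be added, of which
  all but one can be in a tubing.

The function `blocks` is only relevant on the tubes of the tubing and on the universal tubes; it is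
set to be empty on all other sets. -/
@[ext]
structure Template {V C : Type*} (G : SimpleGraph V) (P : Multiset C) where
  tubing : Tubing G
  blocks : Set V → Blocks C
  universalBlock : Multiset C
  blocks_eq_empty : ∀ t, t ∉ tubing.tubes → t ∉ universalTubes G → blocks t = ⟨[], 0⟩
  ordered_tube : ∀ t ∈ tubing.tubes,
    (blocks t).ordered.length = 1 + outerCount G tubing.tubes t
  inner_tube : ∀ t ∈ tubing.tubes,
    (blocks t).ordered.length + (blocks t).inner.card = (coreNodes tubing.tubes t).ncard
  ordered_universal : ∀ t ∈ universalTubes G, t ∉ tubing.tubes →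
    (blocks t).ordered.length = outerCount G tubing.tubes t
  inner_universal : ∀ t ∈ universalTubes G, t ∉ tubing.tubes →
    (blocks t).ordered.length + (blocks t).inner.card + 1 = (coreNodes tubing.tubes t).ncard
  card_universalBlock :
    universalBlock.card + (tubing.tubes ∩ universalTubes G).ncard + 1 = (universalTubes G).ncard
  partition : (∑ᶠ t : Set V, (blocks t).colors) + universalBlock = P

/-- Compatibility of color templates whose tubings differ by one tube `t`: the template `A` is
obtained from `B` by adding `t`.
* If `t` is a universal tube, its color is taken from the universal block of `B`; all other blocks
  remain the same.
* Otherwise let `tstar` be the smallest tube of the tubing, or universal tube, that properly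
  contains `t`.  The blocks of `tstar` in `B` are split, preserving their partial order and choosing
  freely among the colors of the inner block: the first colors go to `tstar`, the remaining ones to
  `t`.  (How many go where is determined by the sizes of the cores.)  All other blocks remain the
  same. -/
def AddTube {V C : Type*} {G : SimpleGraph V} {P : Multiset C} (A B : Template G P) : Prop :=
  ∃ t, t ∉ B.tubing.tubes ∧ A.tubing.tubes = insert t B.tubing.tubes ∧
    ((t ∈ universalTubes G ∧ (∀ s, s ≠ t → A.blocks s = B.blocks s) ∧
        ∃ c, A.blocks t = ⟨c :: (B.blocks t).ordered, (B.blocks t).inner⟩ ∧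
          B.universalBlock = c ::ₘ A.universalBlock) ∨
      (t ∉ universalTubes G ∧ A.universalBlock = B.universalBlock ∧
        ∃ tstar, IsLeast {s | (s ∈ B.tubing.tubes ∨ s ∈ universalTubes G) ∧ t ⊂ s} tstar ∧
          (∀ s, s ≠ t → s ≠ tstar → A.blocks s = B.blocks s) ∧
          ∃ w₁ w₂ : List C, (A.blocks tstar).IsLinearization w₁ ∧ (A.blocks t).IsLinearization w₂ ∧
            (B.blocks tstar).IsLinearization (w₁ ++ w₂)))

theorem eq_or_ssubset_of_reflTransGen {V C : Type*} {G : SimpleGraph V} {P : Multiset C}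
    {A B : Template G P} (h : Relation.ReflTransGen AddTube A B) :
    A = B ∨ B.tubing.tubes ⊂ A.tubing.tubes := by
  induction h with
  | refl => exact Or.inl rfl
  | tail _ hstep ih =>
    obtain ⟨t, ht, hins, _⟩ := hstep
    have hss := Set.ssubset_insert ht
    rw [← hins] at hss
    rcases ih with rfl | ih
    · exact Or.inr hss
    · exact Or.inr (hss.trans ih)

/-- The colorful graph associahedron of `G` with palette `P`, as the poset of its nonempty faces:
these are the color templates, and `A ≤ B` if `A` is obtained from `B` by iteratively adding tubes
in a compatible way. -/
instance {V C : Type*} (G : SimpleGraph V) (P : Multiset C) : PartialOrder (Template G P) where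
  le A B := Relation.ReflTransGen AddTube A B
  le_refl _ := Relation.ReflTransGen.refl
  le_trans _ _ _ h h' := h.trans h'
  le_antisymm A B h h' := by
    rcases eq_or_ssubset_of_reflTransGen h with h | h
    · exact h
    · rcases eq_or_ssubset_of_reflTransGen h' with h' | h'
      · exact h'.symm
      · exact absurd (h.trans h') (ssubset_irrefl _)

/-! ### The pieces of the decomposition -/

/-- The simplex with `m` vertices, as the poset of its nonempty faces: the nonempty sets of
vertices, ordered by inclusion. -/
abbrev Simplex (m : ℕ) : Type := {s : Set (Fin m) // s.Nonempty}

/-- The product of the colorful graph associahedra of the components of `G`, with palettes `Q i`,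
and of the colorful graph associahedron of the null graph on `m` nodes, with palette `Q₀`. -/
abbrev ComponentProduct {V C : Type*} {G : SimpleGraph V} {m : ℕ} (e : Fin m ≃ G.ConnectedComponent)
    (Q : Fin m → Multiset C) (Q₀ : Multiset C) : Type _ :=
  (∀ i, Template (e i).toSimpleGraph (Q i)) × Template (⊥ : SimpleGraph (Fin m)) Q₀

/-- The ordered partitions of the palette `P` into classes of sizes
`|G₁| - 1, …, |Gₘ| - 1` and `m - 1`. -/
@[ext]
structure PalettePartition {V C : Type*} {G : SimpleGraph V} {m : ℕ}
    (e : Fin m ≃ G.ConnectedComponent) (P : Multiset C) where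
  part : Fin m → Multiset C
  last : Multiset C
  card_part : ∀ i, (part i).card + 1 = (e i).supp.ncard
  card_last : last.card + 1 = m
  sum_eq : (∑ i, part i) + last = P

end ColorfulAssoc

open ColorfulAssoc

namespace ColorfulAssoc

/-! ### Universal tubes -/

/-! A connected set of nodes lies in a single component, so a tubing of `G` is the same as a tubing
of each component together with the set of components that occur as tubes. That set is a proper
subset of all components, hence a tubing of the null graph on `m` nodes. Cores are computed inside a
component, so the block sizes agree. The only difference is at a component itself: seen from inside
it is never a tube and carries no tube color, while in `G` it may carry one, placed before all its
other blocks. That color is moved to the template of the null graph, together with the universal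
block. `IsJoin` records this dictionary; `exists_join`, `exists_split`, `IsJoin.parts_unique` and
`IsJoin.unique` make it a bijection.

Adding a component as a tube is a step in the null graph factor. Adding any other tube is a step in
the factor of one component, since a color at the front stays with the surrounding tube when its
blocks are split. Every palette class is the sum of the colors in its factor and no step changes it,
so templates with different palette partitions are incomparable. Thus `joinOrderIso` identifies the
templates of `G` with a disjoint union of products, for every palette.

For a monochrome palette there is only one palette partition, and a template is determined by its
tubing because only block sizes matter (`nonempty_orderIso_tubing`). Tubings of the null graph
correspond, by complements, to nonempty sets of nodes, which gives the simplex. For a full palette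
the terms are counted by choosing the classes one after another. Injective renaming of colors
identifies the terms, and permutations of the palette identify the members of the collection. -/

theorem supp_mem_universalTubes {V : Type*} {G : SimpleGraph V} (c : G.ConnectedComponent) :
    c.supp ∈ universalTubes G := ⟨c, rfl⟩

theorem subset_supp_of_mem {V : Type*} {G : SimpleGraph V} {t : Set V}
    (ht : (G.induce t).Preconnected) {c : G.ConnectedComponent} {v : V} (hv : v ∈ t)
    (hc : v ∈ c.supp) : t ⊆ c.supp := by
  intro w hw
  have h : G.Reachable w v :=
    (ht ⟨w, hw⟩ ⟨v, hv⟩).map (SimpleGraph.Embedding.induce t).toHom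
  rw [SimpleGraph.ConnectedComponent.mem_supp_iff] at hc ⊢
  rw [← hc]
  exact SimpleGraph.ConnectedComponent.sound h

theorem connected_induce_of_mem_universalTubes {V : Type*} {G : SimpleGraph V} {t : Set V}
    (ht : t ∈ universalTubes G) : (G.induce t).Connected := by
  obtain ⟨c, rfl⟩ := ht
  exact c.connected_toSimpleGraph

theorem universalTubes_of_connected {V : Type*} {G : SimpleGraph V} (hG : G.Connected) :
    universalTubes G = {Set.univ} := by
  have key : ∀ c : G.ConnectedComponent, c.supp = Set.univ := by
    intro c
    obtain ⟨v, rfl⟩ := c.exists_rep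
    ext w
    exact ⟨fun _ => trivial, fun _ => SimpleGraph.ConnectedComponent.sound (hG.preconnected w v)⟩
  ext t
  simp only [universalTubes, Set.mem_range, Set.mem_singleton_iff]
  constructor
  · rintro ⟨c, rfl⟩; exact key c
  · rintro rfl
    obtain ⟨v⟩ := hG.nonempty
    exact ⟨G.connectedComponentMk v, key _⟩

/-- The tubes of a tubing together with the universal tubes. -/
def Tubing.all {V : Type*} {G : SimpleGraph V} (T : Tubing G) : Set (Set V) :=
  T.tubes ∪ universalTubes G

section Tubing
variable {V : Type*} {G : SimpleGraph V} (T : Tubing G)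

theorem Tubing.connected {t : Set V} (ht : t ∈ T.all) : (G.induce t).Connected := by
  rcases ht with ht | ht
  · exact (T.isTube t ht).2
  · exact connected_induce_of_mem_universalTubes ht

theorem Tubing.nonempty {t : Set V} (ht : t ∈ T.all) : t.Nonempty := by
  obtain ⟨v⟩ := (T.connected ht).nonempty
  exact ⟨v, v.2⟩

theorem not_ssubset_of_universal {s t : Set V} (hs : s ∈ universalTubes G)
    (ht : (G.induce t).Preconnected) : ¬ s ⊂ t := by
  obtain ⟨c, rfl⟩ := hs
  intro h
  obtain ⟨v, hv⟩ := c.nonempty_supp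
  exact h.2 (subset_supp_of_mem ht (h.1 hv) hv)

/-- Components behave like tubes here: a connected set that meets a component lies inside it, and
one that misses it is not joined to it, because no edge leaves a component. -/
theorem Tubing.compatible_all {s t : Set V} (hs : s ∈ T.all) (ht : t ∈ T.all) (hst : s ≠ t) :
    Compatible G s t := by
  have key : ∀ c : G.ConnectedComponent, ∀ t ∈ T.all, c.supp ≠ t → Compatible G c.supp t := by
    intro c t ht hne
    by_cases h : ∃ v ∈ t, v ∈ c.supp
    · obtain ⟨v, hv, hc⟩ := h
      exact Or.inr (Or.inl
        ((subset_supp_of_mem (T.connected ht).preconnected hv hc).ssubset_of_ne hne.symm))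
    · push Not at h
      refine Or.inr (Or.inr ⟨Set.disjoint_right.2 h, fun x hx y hy hxy => h y hy ?_⟩)
      exact c.mem_supp_of_adj_mem_supp hx hxy
  rcases hs with hs | ⟨c, rfl⟩
  · rcases ht with ht | ⟨c, rfl⟩
    · exact T.compatible hs ht hst
    · rcases key c s (Or.inl hs) hst.symm with h | h | h
      · exact Or.inr (Or.inl h)
      · exact Or.inl h
      · exact Or.inr (Or.inr ⟨h.1.symm, fun x hx y hy hxy => h.2 y hy x hx hxy.symm⟩)
  · exact key c t ht hst

theorem Tubing.eq_or_ssubset {s t : Set V} (hs : s ∈ T.all) (ht : t ∈ T.all) {v : V}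
    (hvs : v ∈ s) (hvt : v ∈ t) : s = t ∨ s ⊂ t ∨ t ⊂ s := by
  by_cases h : s = t
  · exact Or.inl h
  · rcases T.compatible_all hs ht h with h | h | h
    · exact Or.inr (Or.inl h)
    · exact Or.inr (Or.inr h)
    · exact (Set.disjoint_left.1 h.1 hvs hvt).elim

theorem Tubing.mem_tubes_of_ssubset {s t : Set V} (hs : s ∈ T.all) (ht : t ∈ T.all)
    (h : s ⊂ t) : s ∈ T.tubes :=
  hs.resolve_right fun hu => not_ssubset_of_universal hu (T.connected ht).preconnected h

/-- The tubes and universal tubes containing `v` are pairwise comparable, so a minimal one is the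
smallest. Its core contains `v`, and it hides `v` from the cores of all larger ones. Hence the cores
partition the nodes. -/
theorem Tubing.existsUnique_core [Finite V] (v : V) :
    ∃! t, t ∈ T.all ∧ v ∈ coreNodes T.tubes t := by
  have hfin : {t | t ∈ T.all ∧ v ∈ t}.Finite := Set.toFinite _
  obtain ⟨t, ht⟩ := hfin.exists_minimal
    ⟨(G.connectedComponentMk v).supp, Or.inr (supp_mem_universalTubes _), rfl⟩
  refine ⟨t, ⟨ht.1.1, ht.1.2, fun s hs hst hv => hst.2 (ht.2 ⟨Or.inl hs, hv⟩ hst.1)⟩, ?_⟩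
  rintro s ⟨hs, hvs, hcore⟩
  rcases T.eq_or_ssubset hs ht.1.1 hvs ht.1.2 with h | h | h
  · exact h
  · exact (h.2 (ht.2 ⟨hs, hvs⟩ h.1)).elim
  · exact (hcore t (T.mem_tubes_of_ssubset ht.1.1 hs h) h ht.1.2).elim

theorem Tubing.finsum_ncard_coreNodes [Finite V] :
    ∑ᶠ t ∈ T.all, (coreNodes T.tubes t).ncard = Nat.card V := by
  classical
  have := Fintype.ofFinite V
  choose f hf hu using T.existsUnique_core
  rw [finsum_mem_eq_finite_toFinset_sum _ (Set.toFinite T.all), Nat.card_eq_fintype_card,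
    ← Finset.card_univ, Finset.card_eq_sum_card_fiberwise (f := f)
      (t := (Set.toFinite T.all).toFinset) (fun v _ => by simpa using (hf v).1)]
  refine Finset.sum_congr rfl fun t ht => ?_
  rw [← Set.ncard_coe_finset]
  congr 1
  ext v
  simp only [Set.Finite.mem_toFinset] at ht
  simp only [Finset.coe_filter, Finset.mem_univ, true_and, Set.mem_ofPred_eq]
  constructor
  · intro hv; exact (hu v t ⟨ht, hv⟩).symm
  · rintro rfl; exact (hf v).2

/-- Suppose that smaller tubes cover `t`, and let `s` be a maximal one. As `t` is connected, an edge
leaves `s` within `t`, and its far end lies in another tube `r` inside `t`. Maximality excludes `s ⊂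
r`, the far end excludes `r ⊂ s`, and the edge excludes the remaining kind of compatibility. -/
theorem Tubing.coreNodes_nonempty [Finite V] {t : Set V} (ht : t ∈ T.all) :
    (coreNodes T.tubes t).Nonempty := by
  by_contra hne
  have hcov : ∀ v ∈ t, ∃ s ∈ T.tubes, s ⊂ t ∧ v ∈ s := by
    intro v hv
    by_contra h
    push Not at h
    exact hne ⟨v, hv, fun s hs hst hvs => h s hs hst hvs⟩
  obtain ⟨v, hv⟩ := T.nonempty ht
  obtain ⟨s₀, hs₀, hst₀, -⟩ := hcov v hv
  obtain ⟨s, hs⟩ := (Set.toFinite {s | s ∈ T.tubes ∧ s ⊂ t}).exists_maximal ⟨s₀, hs₀, hst₀⟩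
  obtain ⟨x, hx⟩ := T.nonempty (Or.inl hs.1.1)
  obtain ⟨y, hyt, hys⟩ := Set.exists_of_ssubset hs.1.2
  obtain ⟨p⟩ := (T.connected ht).preconnected ⟨x, hs.1.2.1 hx⟩ ⟨y, hyt⟩
  obtain ⟨d, -, hd₁, hd₂⟩ := p.exists_boundary_dart (Subtype.val ⁻¹' s) hx hys
  have hadj : G.Adj d.fst.1 d.snd.1 := d.adj
  obtain ⟨r, hr, hrt, hdr⟩ := hcov d.snd.1 d.snd.2
  have hne : s ≠ r := by rintro rfl; exact hd₂ hdr
  rcases T.compatible hs.1.1 hr hne with h | h | h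
  · exact h.2 (hs.2 ⟨hr, hrt⟩ h.1)
  · exact hd₂ (h.1 hdr)
  · exact h.2 _ hd₁ _ hdr hadj

end Tubing

/-! ### Connectivity and outer blocks -/

theorem connectivity_le_of_iso {W W' : Type*} {H : SimpleGraph W} {H' : SimpleGraph W'}
    (φ : H ≃g H') : connectivity H ≤ connectivity H' := by
  have hne : {k | ∃ S : Set W', S.ncard = k ∧
      (¬ (H'.induce Sᶜ).Preconnected ∨ Sᶜ.Subsingleton)}.Nonempty :=
    ⟨_, Set.univ, rfl, Or.inr (by simp)⟩
  obtain ⟨S, hS, h⟩ := Nat.sInf_mem hne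
  refine Nat.sInf_le ⟨φ ⁻¹' S, ?_, ?_⟩
  · rw [Set.ncard_preimage_of_injective_subset_range φ.injective
      (by rw [φ.surjective.range_eq]; exact Set.subset_univ _), hS]
    rfl
  · rcases h with h | h
    · left
      intro hp
      apply h
      intro x y
      have hx : φ.symm x.1 ∈ (φ ⁻¹' S)ᶜ := fun hm => x.2 (by simpa using hm)
      have hy : φ.symm y.1 ∈ (φ ⁻¹' S)ᶜ := fun hm => y.2 (by simpa using hm)
      let ψ : H.induce (φ ⁻¹' S)ᶜ →g H'.induce Sᶜ :=
        { toFun := fun z => ⟨φ z.1, z.2⟩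
          map_rel' := fun {a b} hab => φ.map_adj_iff.2 hab }
      have := (hp ⟨_, hx⟩ ⟨_, hy⟩).map ψ
      have e1 : ψ ⟨_, hx⟩ = x := Subtype.ext (φ.apply_symm_apply _)
      have e2 : ψ ⟨_, hy⟩ = y := Subtype.ext (φ.apply_symm_apply _)
      rwa [e1, e2] at this
    · right
      intro x hx y hy
      exact φ.injective (h (by exact hx) (by exact hy))

theorem connectivity_congr {W W' : Type*} {H : SimpleGraph W} {H' : SimpleGraph W'}
    (φ : H ≃g H') : connectivity H = connectivity H' :=
  le_antisymm (connectivity_le_of_iso φ) (connectivity_le_of_iso φ.symm)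

/-- Removing all nodes but one is always an admissible removal. -/
theorem connectivity_add_one_le {W : Type*} [Finite W] [Nonempty W] (H : SimpleGraph W) :
    connectivity H + 1 ≤ Nat.card W := by
  obtain ⟨w⟩ := ‹Nonempty W›
  have h : connectivity H ≤ ({w}ᶜ : Set W).ncard :=
    Nat.sInf_le ⟨_, rfl, Or.inr (by simp)⟩
  have := Set.ncard_add_ncard_compl ({w} : Set W)
  rw [Set.ncard_singleton] at this
  omega

/-- Guarantees that the ordered blocks fit: a core has room for the tube color and the outer blocks,
or for the outer blocks alone when one color is missing. The nonempty core covers the case of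
connectivity `0`. -/
theorem outerCount_add_one_le {V : Type*} [Finite V] {G : SimpleGraph V} (T : Tubing G)
    {t : Set V} (ht : t ∈ T.all) :
    outerCount G T.tubes t + 1 ≤ (coreNodes T.tubes t).ncard := by
  have := (T.coreNodes_nonempty ht).to_subtype
  have h := connectivity_add_one_le (coreGraph G T.tubes t)
  rw [Nat.card_coe_set_eq] at h
  unfold outerCount
  omega

/-- The core graphs of two sets of tubes are isomorphic if an injective map identifies their
nodes and adjacencies. -/
theorem outerCount_congr {V W : Type*} {G : SimpleGraph V} {H : SimpleGraph W}
    {T : Set (Set V)} {S : Set (Set W)} {t : Set V} {s : Set W} (f : W → V)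
    (hf : Function.Injective f) (hcore : coreNodes T t = f '' coreNodes S s)
    (hadj : ∀ (x y : W) (hx : x ∈ coreNodes S s) (hy : y ∈ coreNodes S s)
      (hx' : f x ∈ coreNodes T t) (hy' : f y ∈ coreNodes T t),
      (coreGraph G T t).Adj ⟨f x, hx'⟩ ⟨f y, hy'⟩ ↔ (coreGraph H S s).Adj ⟨x, hx⟩ ⟨y, hy⟩) :
    outerCount G T t = outerCount H S s := by
  unfold outerCount
  congr 1
  have hm : ∀ x : coreNodes S s, f x ∈ coreNodes T t := fun x => by
    rw [hcore]; exact Set.mem_image_of_mem f x.2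
  let g : coreNodes S s → coreNodes T t := fun x => ⟨f x, hm x⟩
  have hg : Function.Bijective g := by
    constructor
    · intro x y hxy
      exact Subtype.ext (hf (congrArg Subtype.val hxy))
    · rintro ⟨y, hy⟩
      have hy' := hy
      rw [hcore] at hy'
      obtain ⟨x, hx, rfl⟩ := hy'
      exact ⟨⟨x, hx⟩, rfl⟩
  exact (connectivity_congr
    { toEquiv := Equiv.ofBijective g hg
      map_rel_iff' := fun {x y} => hadj x.1 y.1 x.2 y.2 _ _ }).symm

/-! ### Counting colors -/

/-- The cores partition the nodes and each core node accounts for one color, except that every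
uncolored universal tube is one color short. The second summand makes up for these. -/
theorem card_finsum_add {V : Type*} [Finite V] {G : SimpleGraph V} (T : Tubing G) {C : Type*}
    (b : Set V → Multiset C) (h₀ : ∀ t, t ∉ T.tubes → t ∉ universalTubes G → b t = 0)
    (h₁ : ∀ t ∈ T.tubes, (b t).card = (coreNodes T.tubes t).ncard)
    (h₂ : ∀ t ∈ universalTubes G, t ∉ T.tubes → (b t).card + 1 = (coreNodes T.tubes t).ncard) :
    (∑ᶠ t, b t).card + (universalTubes G \ T.tubes).ncard = Nat.card V := by
  classical
  have := Fintype.ofFinite V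
  have hU : (universalTubes G \ T.tubes).ncard =
      ∑ t : Set V, if t ∈ universalTubes G \ T.tubes then 1 else 0 := by
    rw [Finset.sum_boole, Nat.cast_id, ← Set.ncard_coe_finset]
    congr 1
    ext t
    simp
  rw [← T.finsum_ncard_coreNodes, finsum_mem_def, finsum_eq_sum_of_fintype,
    finsum_eq_sum_of_fintype, Multiset.card_sum, hU, ← Finset.sum_add_distrib]
  refine Finset.sum_congr rfl fun t _ => ?_
  by_cases hT : t ∈ T.tubes
  · have : t ∈ T.all := Or.inl hT
    simp [hT, this, h₁ t hT]
  · by_cases hu : t ∈ universalTubes G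
    · have : t ∈ T.all := Or.inr hu
      simp [hT, hu, this, ← h₂ t hu hT]
    · have : t ∉ T.all := fun h => h.elim hT hu
      simp [hu, this, h₀ t hT hu]

/-! ### Changing the colors -/

/-- The orders on templates are generated by single steps. By surjectivity the intermediate elements
of a chain can be pulled back, so reflecting single steps is enough for reflecting the order. -/
theorem le_of_reflTransGen_map {X Y : Type*} [Preorder X] {r : Y → Y → Prop} {F : X → Y}
    (hF : Function.Bijective F) (h : ∀ x y, r (F x) (F y) → x ≤ y) {x y : X}
    (hxy : Relation.ReflTransGen r (F x) (F y)) : x ≤ y := by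
  have key : ∀ a b, Relation.ReflTransGen r a b → ∀ x y, F x = a → F y = b → x ≤ y := by
    intro a b hab
    induction hab with
    | refl => rintro x y rfl hy; exact (hF.1 hy).ge
    | tail _ hbc ih =>
      rintro x y hx rfl
      obtain ⟨z, hz⟩ := hF.2 _
      exact (ih x z hx hz).trans (h z y (hz ▸ hbc))
  exact key _ _ hxy x y rfl rfl

/-- Rename the colors of blocks. -/
def Blocks.map {C D : Type*} (f : C → D) (b : Blocks C) : Blocks D :=
  ⟨b.ordered.map f, b.inner.map f⟩

theorem Blocks.colors_map {C D : Type*} (f : C → D) (b : Blocks C) :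
    (b.map f).colors = b.colors.map f := by
  simp [Blocks.colors, Blocks.map]

theorem Blocks.map_injective {C D : Type*} {f : C → D} (hf : Function.Injective f) :
    Function.Injective (Blocks.map f) := by
  intro a b h
  have h₁ := congrArg Blocks.ordered h
  have h₂ := congrArg Blocks.inner h
  exact Blocks.ext (hf.list_map h₁) (Multiset.map_injective hf h₂)

theorem exists_multiset_map_eq {C D : Type*} {f : C → D} {s : Multiset D}
    (h : ∀ x ∈ s, x ∈ Set.range f) : ∃ t : Multiset C, t.map f = s := by
  induction s using Quotient.inductionOn with
  | h l =>
    have : l ∈ Set.range (List.map f) := by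
      rw [Set.range_list_map]
      exact fun x hx => h x (by simpa using hx)
    obtain ⟨k, hk⟩ := this
    exact ⟨k, by simp [hk]⟩

theorem Blocks.exists_map_eq {C D : Type*} {f : C → D} {b : Blocks D}
    (h : ∀ x ∈ b.colors, x ∈ Set.range f) : ∃ a : Blocks C, a.map f = b := by
  have h₁ : b.ordered ∈ Set.range (List.map f) := by
    rw [Set.range_list_map]
    exact fun x hx => h x (by simp [Blocks.colors, hx])
  obtain ⟨l, hl⟩ := h₁
  obtain ⟨s, hs⟩ := exists_multiset_map_eq (f := f) (s := b.inner)
    fun x hx => h x (by simp [Blocks.colors, hx])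
  exact ⟨⟨l, s⟩, Blocks.ext hl hs⟩

theorem Blocks.isLinearization_map {C D : Type*} {f : C → D} (hf : Function.Injective f)
    {b : Blocks C} {w : List C} : (b.map f).IsLinearization (w.map f) ↔ b.IsLinearization w := by
  constructor
  · rintro ⟨l, hl, hw⟩
    obtain ⟨w₁, w₂, rfl, h₁, h₂⟩ := List.map_eq_append_iff.1 hw
    refine ⟨w₂, Multiset.map_injective hf ?_, by rw [hf.list_map h₁]⟩
    rw [Multiset.map_coe, h₂, hl]
    rfl
  · rintro ⟨l, hl, rfl⟩
    exact ⟨l.map f, by rw [← Multiset.map_coe, hl]; rfl, by simp [Blocks.map]⟩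

theorem Blocks.IsLinearization.coe {C : Type*} {b : Blocks C} {w : List C}
    (h : b.IsLinearization w) : (w : Multiset C) = b.colors := by
  obtain ⟨l, hl, rfl⟩ := h
  simp [Blocks.colors, ← hl]

theorem Blocks.exists_eq_map_of_isLinearization {C D : Type*} {f : C → D} {b : Blocks C}
    {w : List D} (h : (b.map f).IsLinearization w) : ∃ v : List C, v.map f = w := by
  have : w ∈ Set.range (List.map f) := by
    rw [Set.range_list_map]
    intro x hx
    have hx' : x ∈ (w : Multiset D) := hx
    rw [h.coe, Blocks.colors_map, Multiset.mem_map] at hx'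
    obtain ⟨c, -, rfl⟩ := hx'
    exact ⟨c, rfl⟩
  exact this

section Map
variable {V : Type*} {G : SimpleGraph V} {C D : Type*} {P : Multiset C}
  {Q : Multiset D}

theorem Template.universalBlock_le (A : Template G P) : A.universalBlock ≤ P :=
  (Multiset.le_add_left _ _).trans_eq A.partition

variable [Finite V]

theorem Template.colors_le (A : Template G P) (t : Set V) : (A.blocks t).colors ≤ P := by
  classical
  have := Fintype.ofFinite V
  have h := A.partition
  rw [finsum_eq_sum_of_fintype] at h
  refine le_trans ?_ h.le
  exact (Finset.single_le_sum (f := fun t => (A.blocks t).colors) (fun _ _ => Multiset.zero_le _)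
    (Finset.mem_univ t)).trans (Multiset.le_add_right _ _)

theorem finsum_colors_map (f : C → D) (b : Set V → Blocks C) :
    ∑ᶠ t, ((b t).map f).colors = (∑ᶠ t, (b t).colors).map f := by
  simp_rw [Blocks.colors_map]
  exact ((Multiset.mapAddMonoidHom f).map_finsum (Set.toFinite _)).symm

/-- Rename the colors of a template. -/
def Template.map (f : C → D) (h : P.map f = Q) (A : Template G P) : Template G Q where
  tubing := A.tubing
  blocks t := (A.blocks t).map f
  universalBlock := A.universalBlock.map f
  blocks_eq_empty t h₁ h₂ := by rw [A.blocks_eq_empty t h₁ h₂]; rfl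
  ordered_tube t ht := by simpa [Blocks.map] using A.ordered_tube t ht
  inner_tube t ht := by simpa [Blocks.map] using A.inner_tube t ht
  ordered_universal t ht := by simpa [Blocks.map] using A.ordered_universal t ht
  inner_universal t ht := by simpa [Blocks.map] using A.inner_universal t ht
  card_universalBlock := by simpa using A.card_universalBlock
  partition := by rw [finsum_colors_map, ← Multiset.map_add, A.partition, h]

/-- For surjectivity, all colors in a template come from its palette, which lies in the range of
`f`, so every block can be pulled back. -/
theorem Template.map_bijective {f : C → D} (hf : Function.Injective f) (h : P.map f = Q) :
    Function.Bijective (Template.map (G := G) f h) := by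
  constructor
  · intro A B hAB
    refine Template.ext ?_ (funext fun t => Blocks.map_injective hf ?_)
      (Multiset.map_injective hf ?_)
    · exact congrArg (Template.tubing (P := Q)) hAB
    · exact congrFun (congrArg (Template.blocks (P := Q)) hAB) t
    · exact congrArg (Template.universalBlock (P := Q)) hAB
  · intro B
    have hP : ∀ x ∈ Q, x ∈ Set.range f := by
      intro x hx
      rw [← h, Multiset.mem_map] at hx
      obtain ⟨c, -, rfl⟩ := hx
      exact ⟨c, rfl⟩
    choose b hb using fun t => Blocks.exists_map_eq (f := f) (b := B.blocks t)
      fun x hx => hP x (Multiset.mem_of_le (B.colors_le t) hx)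
    obtain ⟨u, hu⟩ := exists_multiset_map_eq (f := f) (s := B.universalBlock)
      fun x hx => hP x (Multiset.mem_of_le B.universalBlock_le hx)
    have ho : ∀ t, (B.blocks t).ordered.length = (b t).ordered.length := fun t => by
      rw [← hb t]; simp [Blocks.map]
    have hi : ∀ t, (B.blocks t).inner.card = (b t).inner.card := fun t => by
      rw [← hb t]; simp [Blocks.map]
    refine ⟨⟨B.tubing, b, u, ?_, ?_, ?_, ?_, ?_, ?_, ?_⟩,
      Template.ext rfl (funext hb) hu⟩
    · intro t h₁ h₂
      refine Blocks.map_injective hf ?_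
      rw [hb, B.blocks_eq_empty t h₁ h₂]
      rfl
    · intro t ht; rw [← ho]; exact B.ordered_tube t ht
    · intro t ht; rw [← ho, ← hi]; exact B.inner_tube t ht
    · intro t ht; rw [← ho]; exact B.ordered_universal t ht
    · intro t ht; rw [← ho, ← hi]; exact B.inner_universal t ht
    · rw [← B.card_universalBlock, ← hu, Multiset.card_map]
    · refine Multiset.map_injective hf ?_
      rw [Multiset.map_add, ← finsum_colors_map, hu, h]
      simp_rw [hb]
      exact B.partition

/-- A step only compares colors for equality. The colors and lists that witness a step between
renamed templates occur in renamed blocks, so they are themselves renamed. -/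
theorem addTube_map_iff {f : C → D} (hf : Function.Injective f) (h : P.map f = Q)
    (A B : Template G P) : AddTube (A.map f h) (B.map f h) ↔ AddTube A B := by
  have hinj := Blocks.map_injective hf
  unfold AddTube
  refine exists_congr fun t => and_congr_right fun _ => and_congr_right fun _ => or_congr
    (and_congr_right fun _ => and_congr (forall₂_congr fun s _ => hinj.eq_iff) ?_)
    (and_congr_right fun _ => and_congr (Multiset.map_injective hf).eq_iff
      (exists_congr fun s => and_congr_right fun _ => and_congr
        (forall₃_congr fun r _ _ => hinj.eq_iff) ?_))
  · constructor
    · rintro ⟨d, h₁, h₂⟩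
      have hd : d ∈ B.universalBlock.map f := by
        have : d ∈ (B.map f h).universalBlock := by rw [h₂]; simp
        exact this
      obtain ⟨c, -, rfl⟩ := Multiset.mem_map.1 hd
      refine ⟨c, hinj ?_, Multiset.map_injective hf ?_⟩
      · refine h₁.trans ?_
        simp [Blocks.map, Template.map]
      · refine h₂.trans ?_
        simp [Template.map]
    · rintro ⟨c, h₁, h₂⟩
      refine ⟨f c, ?_, ?_⟩
      · simp [Blocks.map, Template.map, h₁]
      · simp [Template.map, h₂]
  · constructor
    · rintro ⟨w₁, w₂, h₁, h₂, h₃⟩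
      obtain ⟨v₁, rfl⟩ := Blocks.exists_eq_map_of_isLinearization h₁
      obtain ⟨v₂, rfl⟩ := Blocks.exists_eq_map_of_isLinearization h₂
      rw [← List.map_append] at h₃
      exact ⟨v₁, v₂, (Blocks.isLinearization_map hf).1 h₁, (Blocks.isLinearization_map hf).1 h₂,
        (Blocks.isLinearization_map hf).1 h₃⟩
    · rintro ⟨v₁, v₂, h₁, h₂, h₃⟩
      refine ⟨v₁.map f, v₂.map f, (Blocks.isLinearization_map hf).2 h₁,
        (Blocks.isLinearization_map hf).2 h₂, ?_⟩
      rw [← List.map_append]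
      exact (Blocks.isLinearization_map hf).2 h₃

/-- An injective renaming of the colors is an isomorphism of colorful graph associahedra. -/
noncomputable def Template.mapOrderIso {f : C → D} (hf : Function.Injective f)
    (h : P.map f = Q) : Template G P ≃o Template G Q where
  toEquiv := Equiv.ofBijective _ (Template.map_bijective hf h)
  map_rel_iff' {A B} := by
    constructor
    · intro hAB
      exact le_of_reflTransGen_map (Template.map_bijective hf h)
        (fun x y hxy => Relation.ReflTransGen.single ((addTube_map_iff hf h x y).1 hxy)) hAB
    · intro hAB
      exact Relation.ReflTransGen.lift (r := AddTube) (p := AddTube) (Template.map f h)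
        (fun x y hxy => (addTube_map_iff hf h x y).2 hxy) _ _ hAB

theorem exists_map_univ_fin_eq (hP : P.Nodup) {n : ℕ} (h : P.card = n) :
    ∃ f : Fin n → C, Function.Injective f ∧ (Finset.univ.val : Multiset (Fin n)).map f = P := by
  subst h
  induction P using Quotient.inductionOn with | h l => ?_
  exact ⟨l.get, List.nodup_iff_injective_get.1 hP, by
    change Multiset.map l.get (Finset.univ : Finset (Fin l.length)).val = l
    simp⟩

/-- The two palettes may live in unrelated color types, so both are compared with the palette of all
elements of `Fin Q.card`. -/
theorem Template.nonempty_orderIso_of_nodup (hP : P.Nodup) (hQ : Q.Nodup)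
    (h : P.card = Q.card) : Nonempty (Template G P ≃o Template G Q) := by
  obtain ⟨f, hf, hfP⟩ := exists_map_univ_fin_eq hP h
  obtain ⟨g, hg, hgQ⟩ := exists_map_univ_fin_eq hQ rfl
  exact ⟨(Template.mapOrderIso hf hfP).symm.trans (Template.mapOrderIso hg hgQ)⟩

end Map

/-- The symmetric group of any set, finite or not, acts transitively on injective tuples of a given
length. -/
theorem exists_perm_map_eq {C : Type*} {l k : List C} (hl : l.Nodup) (hk : k.Nodup)
    (h : l.length = k.length) : ∃ σ : Equiv.Perm C, l.map σ = k := by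
  have := Equiv.Perm.isMultiplyPretransitive C l.length
  let a : Fin l.length ↪ C := ⟨l.get, List.nodup_iff_injective_get.1 hl⟩
  let b : Fin l.length ↪ C := ⟨fun i => k.get (i.cast h),
    (List.nodup_iff_injective_get.1 hk).comp (finCongr h).injective⟩
  obtain ⟨σ, hσ⟩ := MulAction.exists_smul_eq (Equiv.Perm C) a b
  refine ⟨σ, List.ext_getElem (by simpa using h) fun i h₁ h₂ => ?_⟩
  have := DFunLike.congr_fun hσ ⟨i, by simpa using h₁⟩
  simpa [a, b] using this

theorem map_eq_of_map_flatMap_eq {S C D : Type*} {f : S → List C} {g : S → List D} (σ : C → D)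
    (h : ∀ s, (f s).length = (g s).length) {l : List S}
    (hl : (l.flatMap f).map σ = l.flatMap g) : ∀ s ∈ l, (f s).map σ = g s := by
  induction l with
  | nil => simp
  | cons a l ih =>
    rw [List.flatMap_cons, List.flatMap_cons, List.map_append] at hl
    obtain ⟨h₁, h₂⟩ := List.append_inj hl (by simp [h])
    simp only [List.mem_cons, forall_eq_or_imp]
    exact ⟨h₁, ih h₂⟩

/-- Equal tubings force equal block sizes. Listing the colors of `A` and of `B` block by block in
the same order gives two repetition-free lists of the palette. A permutation of colors taking one
list to the other preserves the palette, so it induces an automorphism of the whole poset that takes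
`A` to `B`, and it restricts to the lower sets. -/
theorem nonempty_Iic_orderIso {V : Type*} [Finite V] {G : SimpleGraph V} {C : Type*}
    {P : Multiset C} (hP : P.Nodup) (A B : Template G P) (hAB : A.tubing = B.tubing) :
    Nonempty (Set.Iic A ≃o Set.Iic B) := by
  classical
  have := Fintype.ofFinite V
  have hord : ∀ t, (A.blocks t).ordered.length = (B.blocks t).ordered.length := by
    intro t
    by_cases ht : t ∈ A.tubing.tubes
    · rw [A.ordered_tube t ht, B.ordered_tube t (hAB ▸ ht), hAB]
    · by_cases hu : t ∈ universalTubes G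
      · rw [A.ordered_universal t hu ht, B.ordered_universal t hu (hAB ▸ ht), hAB]
      · rw [A.blocks_eq_empty t ht hu, B.blocks_eq_empty t (hAB ▸ ht) hu]
  have hin : ∀ t, (A.blocks t).inner.card = (B.blocks t).inner.card := by
    intro t
    by_cases ht : t ∈ A.tubing.tubes
    · have h₁ := A.inner_tube t ht
      have h₂ := B.inner_tube t (hAB ▸ ht)
      have := hord t
      rw [← hAB] at h₂
      omega
    · by_cases hu : t ∈ universalTubes G
      · have h₁ := A.inner_universal t hu ht
        have h₂ := B.inner_universal t hu (hAB ▸ ht)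
        have := hord t
        rw [← hAB] at h₂
        omega
      · rw [A.blocks_eq_empty t ht hu, B.blocks_eq_empty t (hAB ▸ ht) hu]
  -- The order chosen inside an inner block is irrelevant, as it is forgotten again when `hmap`
  -- compares the blocks.
  let f : Template G P → Set V → List C := fun X t =>
    (X.blocks t).ordered ++ (X.blocks t).inner.toList
  let L : Template G P → List C := fun X =>
    Finset.univ.toList.flatMap (f X) ++ X.universalBlock.toList
  have hL : ∀ X : Template G P, (L X : Multiset C) = P := by
    intro X
    have h := X.partition
    rw [finsum_eq_sum_of_fintype] at h
    refine Eq.trans ?_ h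
    rw [← Multiset.coe_add, Multiset.coe_toList, ← Finset.sum_map_toList]
    congr 1
    generalize (Finset.univ : Finset (Set V)).toList = l
    induction l with
    | nil => simp
    | cons a l ih =>
      rw [List.flatMap_cons, ← Multiset.coe_add, ih]
      simp [f, Blocks.colors, ← Multiset.coe_add]
  have hnd : ∀ X : Template G P, (L X).Nodup := fun X => by
    rw [← Multiset.coe_nodup, hL]; exact hP
  obtain ⟨σ, hσ⟩ := exists_perm_map_eq (hnd A) (hnd B) (by
    rw [← Multiset.coe_card, hL, ← Multiset.coe_card, hL])
  have hPσ : P.map σ = P := by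
    nth_rewrite 1 [← hL A]
    rw [Multiset.map_coe, hσ, hL]
  have hu : A.universalBlock.card = B.universalBlock.card := by
    have h₁ := A.card_universalBlock
    have h₂ := B.card_universalBlock
    rw [← hAB] at h₂
    omega
  obtain ⟨h₁, h₂⟩ := List.append_inj' (by simpa only [L, List.map_append] using hσ)
    (by simp [hu])
  have hf := map_eq_of_map_flatMap_eq (f := f A) (g := f B) σ (fun t => by simp [f, hord, hin]) h₁
  have hmap : Template.mapOrderIso (G := G) σ.injective hPσ A = B := by
    refine Template.ext hAB (funext fun t => ?_) ?_
    · obtain ⟨h₃, h₄⟩ := List.append_inj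
        (by simpa only [f, List.map_append] using hf t (by simp)) (by simp [hord])
      refine Blocks.ext h₃ ?_
      have := congrArg (fun l : List C => (l : Multiset C)) h₄
      rw [← Multiset.map_coe, Multiset.coe_toList, Multiset.coe_toList] at this
      exact this
    · have := congrArg (fun l : List C => (l : Multiset C)) h₂
      rw [← Multiset.map_coe, Multiset.coe_toList, Multiset.coe_toList] at this
      exact this
  let φ := Template.mapOrderIso (G := G) σ.injective hPσ
  exact ⟨{ toEquiv := φ.toEquiv.subtypeEquiv fun X => by
             change X ≤ A ↔ φ X ≤ B
             rw [← hmap]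
             exact φ.le_iff_le.symm
           map_rel_iff' := fun {X Y} => φ.le_iff_le }⟩

/-! ### Adding one tube -/

/-- Removing tubes from a tubing. -/
def Tubing.restrict {V : Type*} {G : SimpleGraph V} (T : Tubing G) (S : Set (Set V))
    (h : S ⊆ T.tubes) : Tubing G where
  tubes := S
  isTube t ht := T.isTube t (h ht)
  compatible := T.compatible.mono h
  not_all hS := T.not_all (hS.trans h)

/-- The candidates share the nodes of `t`, so they form a chain, and the component of `t` is one of
them. -/
theorem Tubing.exists_isLeast {V : Type*} [Finite V] {G : SimpleGraph V} (T : Tubing G)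
    {t : Set V} (ht : (G.induce t).Connected) (hu : t ∉ universalTubes G) :
    ∃ r, IsLeast {s | (s ∈ T.tubes ∨ s ∈ universalTubes G) ∧ t ⊂ s} r := by
  obtain ⟨v⟩ := ht.nonempty
  have hne : {s | (s ∈ T.tubes ∨ s ∈ universalTubes G) ∧ t ⊂ s}.Nonempty := by
    refine ⟨(G.connectedComponentMk v).supp, Or.inr (supp_mem_universalTubes _), ?_⟩
    refine (subset_supp_of_mem ht.preconnected v.2 rfl).ssubset_of_ne ?_
    rintro h
    exact hu (h ▸ supp_mem_universalTubes _)
  obtain ⟨r, hr⟩ := (Set.toFinite _).exists_minimal hne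
  refine ⟨r, hr.1, fun s hs => ?_⟩
  rcases T.eq_or_ssubset hr.1.1 hs.1 (hr.1.2.1 v.2) (hs.2.1 v.2) with h | h | h
  · exact h.le
  · exact h.1
  · exact hr.2 hs h.1

section AddTube
variable {V : Type*} {G : SimpleGraph V} {A B : Tubing G} {t : Set V}
  (ht : t ∉ B.tubes) (hA : A.tubes = insert t B.tubes)
include ht hA

/-- Adding a tube does not change the core of a tube that does not contain it. -/
theorem core_eq_of_not_ssubset {s : Set V} (h : ¬ t ⊂ s) :
    coreNodes A.tubes s = coreNodes B.tubes s ∧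
      outerCount G A.tubes s = outerCount G B.tubes s := by
  have hiff : ∀ r, r ∈ A.tubes ∧ r ⊂ s ↔ r ∈ B.tubes ∧ r ⊂ s := by
    intro r
    rw [hA]
    constructor
    · rintro ⟨rfl | hr, hrs⟩
      · exact (h hrs).elim
      · exact ⟨hr, hrs⟩
    · rintro ⟨hr, hrs⟩; exact ⟨Or.inr hr, hrs⟩
  have hcore : coreNodes A.tubes s = coreNodes B.tubes s := by
    ext v
    refine and_congr_right fun _ => ⟨fun hv r hr hrs => ?_, fun hv r hr hrs => ?_⟩
    · exact hv r ((hiff r).2 ⟨hr, hrs⟩).1 hrs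
    · exact hv r ((hiff r).1 ⟨hr, hrs⟩).1 hrs
  refine ⟨hcore, outerCount_congr id Function.injective_id (by simpa using hcore) ?_⟩
  intro x y hx hy hx' hy'
  simp only [coreGraph, ne_eq, Subtype.mk.injEq, id]
  refine and_congr_right fun _ => or_congr_right (exists_congr fun r => ?_)
  rw [← and_assoc, hiff, and_assoc]

variable {r : Set V}
  (hr : IsLeast {s | (s ∈ B.tubes ∨ s ∈ universalTubes G) ∧ t ⊂ s} r)
include hr

/-- If `t ⊂ s`, then `r` is already a tube strictly inside `s` and contains `t`. So `t` hides no
further nodes of `s`, and a path through `t` is also a path through `r`. -/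
theorem core_eq_of_ne {s : Set V} (hs : s ∈ B.all) (hsr : s ≠ r) :
    coreNodes A.tubes s = coreNodes B.tubes s ∧
      outerCount G A.tubes s = outerCount G B.tubes s := by
  by_cases hts : t ⊂ s
  · have hrs : r ⊂ s := (hr.2 ⟨hs, hts⟩).ssubset_of_ne hsr.symm
    have hrB : r ∈ B.tubes := B.mem_tubes_of_ssubset hr.1.1 hs hrs
    have hcore : coreNodes A.tubes s = coreNodes B.tubes s := by
      ext v
      refine and_congr_right fun _ => ⟨fun hv q hq hqs => ?_, fun hv q hq hqs => ?_⟩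
      · exact hv q (hA ▸ Or.inr hq) hqs
      · rw [hA] at hq
        rcases hq with rfl | hq
        · exact fun hvq => hv r hrB hrs (hr.1.2.1 hvq)
        · exact hv q hq hqs
    refine ⟨hcore, outerCount_congr id Function.injective_id (by simpa using hcore) ?_⟩
    intro x y hx hy hx' hy'
    simp only [coreGraph, ne_eq, Subtype.mk.injEq, id]
    refine and_congr_right fun _ => or_congr_right ⟨?_, ?_⟩
    · rintro ⟨q, hq, hqs, ⟨a, ha, hxa⟩, ⟨b, hb, hyb⟩⟩
      rw [hA] at hq
      rcases hq with rfl | hq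
      · exact ⟨r, hrB, hrs, ⟨a, hr.1.2.1 ha, hxa⟩, ⟨b, hr.1.2.1 hb, hyb⟩⟩
      · exact ⟨q, hq, hqs, ⟨a, ha, hxa⟩, ⟨b, hb, hyb⟩⟩
    · rintro ⟨q, hq, hqs, h⟩
      exact ⟨q, hA ▸ Or.inr hq, hqs, h⟩
  · exact core_eq_of_not_ssubset ht hA hts

/-- The old core of `r` is divided into its nodes outside `t` and inside `t`. The latter form the
core of `t`: a tube properly between `t` and `r` would contradict the choice of `r`. This matches
the way the colors of `r` are divided. -/
theorem ncard_core_add [Finite V] :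
    (coreNodes B.tubes r).ncard =
      (coreNodes A.tubes r).ncard + (coreNodes A.tubes t).ncard := by
  rw [← Set.ncard_union_eq]
  · congr 1
    ext v
    constructor
    · rintro ⟨hv, hvB⟩
      by_cases hvt : v ∈ t
      · right
        refine ⟨hvt, fun s hs hst => ?_⟩
        rw [hA] at hs
        rcases hs with rfl | hs
        · exact (ssubset_irrefl _ hst).elim
        · exact hvB s hs (hst.trans hr.1.2)
      · left
        refine ⟨hv, fun s hs hst => ?_⟩
        rw [hA] at hs
        rcases hs with rfl | hs
        · exact hvt
        · exact hvB s hs hst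
    · rintro (⟨hv, hvA⟩ | ⟨hv, hvA⟩)
      · exact ⟨hv, fun s hs hst => hvA s (hA ▸ Or.inr hs) hst⟩
      · refine ⟨hr.1.2.1 hv, fun s hs hsr hvs => ?_⟩
        have hsA : s ∈ A.tubes := hA ▸ Or.inr hs
        have htA : t ∈ A.tubes := hA ▸ Or.inl rfl
        rcases A.eq_or_ssubset (Or.inl hsA) (Or.inl htA) hvs hv with h | h | h
        · exact ht (h ▸ hs)
        · exact hvA s hsA h hvs
        · exact hsr.2 (hr.2 ⟨Or.inl hs, h⟩)
  · rw [Set.disjoint_left]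
    rintro v ⟨-, hv⟩ ⟨hvt, -⟩
    exact hv t (hA ▸ Or.inl rfl) hr.1.2 hvt

end AddTube

/-! ### Monochrome palettes -/

/-- The number of ordered blocks of a set of nodes in a template with tubing `T`. -/
noncomputable def Tubing.orderedLength {V : Type*} {G : SimpleGraph V} (T : Tubing G)
    (t : Set V) : ℕ := by
  classical exact
    if t ∈ T.tubes then 1 + outerCount G T.tubes t
    else if t ∈ universalTubes G then outerCount G T.tubes t else 0

/-- The number of colors of a set of nodes in a template with tubing `T`. -/
noncomputable def Tubing.colorCount {V : Type*} {G : SimpleGraph V} (T : Tubing G)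
    (t : Set V) : ℕ := by
  classical exact
    if t ∈ T.tubes then (coreNodes T.tubes t).ncard
    else if t ∈ universalTubes G then (coreNodes T.tubes t).ncard - 1 else 0

theorem Tubing.orderedLength_le_colorCount {V : Type*} [Finite V] {G : SimpleGraph V}
    (T : Tubing G) (t : Set V) : T.orderedLength t ≤ T.colorCount t := by
  unfold orderedLength colorCount
  split_ifs with h₁ h₂
  · have := outerCount_add_one_le T (t := t) (Or.inl h₁)
    omega
  · have := outerCount_add_one_le T (t := t) (Or.inr h₂)
    omega
  · exact le_rfl

section Template
variable {V : Type*} {G : SimpleGraph V} {C : Type*} {P : Multiset C}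

theorem Template.length_ordered (A : Template G P) (t : Set V) :
    (A.blocks t).ordered.length = A.tubing.orderedLength t := by
  unfold Tubing.orderedLength
  split_ifs with h₁ h₂
  · exact A.ordered_tube t h₁
  · exact A.ordered_universal t h₂ h₁
  · rw [A.blocks_eq_empty t h₁ h₂]; rfl

theorem Template.card_colors (A : Template G P) (t : Set V) :
    (A.blocks t).colors.card = A.tubing.colorCount t := by
  unfold Tubing.colorCount Blocks.colors
  rw [Multiset.card_add, Multiset.coe_card]
  split_ifs with h₁ h₂
  · exact A.inner_tube t h₁
  · have := A.inner_universal t h₂ h₁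
    omega
  · rw [A.blocks_eq_empty t h₁ h₂]; rfl

end Template

section Monochrome
variable {V : Type*} [Finite V] {G : SimpleGraph V} {C : Type*}

theorem ncard_universalTubes_sdiff (T : Tubing G) :
    (universalTubes G \ T.tubes).ncard + (T.tubes ∩ universalTubes G).ncard =
      (universalTubes G).ncard := by
  rw [Set.inter_comm, add_comm, Set.ncard_inter_add_ncard_sdiff_eq_ncard _ _ (Set.toFinite _)]

theorem ncard_universalTubes_sdiff_pos (T : Tubing G) :
    0 < (universalTubes G \ T.tubes).ncard := by
  rw [Set.ncard_pos (Set.toFinite _), Set.nonempty_iff_ne_empty, Ne, Set.sdiff_eq_empty]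
  exact T.not_all

theorem Blocks.eq_of_monochrome {a : C} {b b' : Blocks C} (h : ∀ x ∈ b.colors, x = a)
    (h' : ∀ x ∈ b'.colors, x = a) (h₁ : b.ordered.length = b'.ordered.length)
    (h₂ : b.colors.card = b'.colors.card) : b = b' := by
  simp only [Blocks.colors, Multiset.mem_add, Multiset.mem_coe, Multiset.card_add,
    Multiset.coe_card] at h h' h₂
  have e₁ := List.eq_replicate_of_mem fun x hx => h x (Or.inl hx)
  have e₂ := List.eq_replicate_of_mem fun x hx => h' x (Or.inl hx)
  have e₃ := Multiset.eq_replicate_of_mem fun x hx => h x (Or.inr hx)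
  have e₄ := Multiset.eq_replicate_of_mem fun x hx => h' x (Or.inr hx)
  refine Blocks.ext ?_ ?_
  · rw [e₁, e₂, h₁]
  · rw [e₃, e₄]; congr 1; omega

theorem Blocks.isLinearization_replicate {a : C} {b : Blocks C} (h : ∀ x ∈ b.colors, x = a) :
    b.IsLinearization (List.replicate b.colors.card a) := by
  simp only [Blocks.colors, Multiset.mem_add, Multiset.mem_coe] at h
  have e₁ := List.eq_replicate_of_mem fun x hx => h x (Or.inl hx)
  have e₃ := Multiset.eq_replicate_of_mem fun x hx => h x (Or.inr hx)
  refine ⟨List.replicate b.inner.card a, by rw [Multiset.coe_replicate, ← e₃], ?_⟩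
  rw [Blocks.colors, Multiset.card_add, Multiset.coe_card, List.replicate_add, ← e₁]

/-- The template on a given tubing that uses only one color. -/
noncomputable def Template.const (a : C) (T : Tubing G) :
    Template G (Multiset.replicate (Nat.card V - 1) a) where
  tubing := T
  blocks t := ⟨List.replicate (T.orderedLength t) a,
    Multiset.replicate (T.colorCount t - T.orderedLength t) a⟩
  -- Some component is missing from `T`, so this subtraction is not truncated.
  universalBlock := Multiset.replicate ((universalTubes G \ T.tubes).ncard - 1) a
  blocks_eq_empty t h₁ h₂ := by simp [Tubing.orderedLength, Tubing.colorCount, h₁, h₂]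
  ordered_tube t ht := by simp [Tubing.orderedLength, ht]
  inner_tube t ht := by
    have := T.orderedLength_le_colorCount t
    simp only [List.length_replicate, Multiset.card_replicate, Nat.add_sub_cancel' this]
    simp [Tubing.colorCount, ht]
  ordered_universal t hu ht := by simp [Tubing.orderedLength, ht, hu]
  inner_universal t hu ht := by
    have := T.orderedLength_le_colorCount t
    simp only [List.length_replicate, Multiset.card_replicate, Nat.add_sub_cancel' this]
    have := outerCount_add_one_le T (t := t) (Or.inr hu)
    simp only [Tubing.colorCount, ht, hu, if_true, if_false]
    omega
  card_universalBlock := by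
    have h₁ := ncard_universalTubes_sdiff T
    have h₂ := ncard_universalTubes_sdiff_pos T
    rw [Multiset.card_replicate]
    omega
  partition := by
    have hc : ∀ t, Blocks.colors ⟨List.replicate (T.orderedLength t) a,
        Multiset.replicate (T.colorCount t - T.orderedLength t) a⟩ =
        Multiset.replicate (T.colorCount t) a := by
      intro t
      rw [Blocks.colors, Multiset.coe_replicate, ← Multiset.replicate_add,
        Nat.add_sub_cancel' (T.orderedLength_le_colorCount t)]
    simp_rw [hc]
    refine Multiset.eq_replicate.2 ⟨?_, ?_⟩
    · have h := card_finsum_add T (fun t => Multiset.replicate (T.colorCount t) a)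
        (fun t h₁ h₂ => by simp [Tubing.colorCount, h₁, h₂])
        (fun t ht => by simp [Tubing.colorCount, ht])
        (fun t hu ht => by
          have := outerCount_add_one_le T (t := t) (Or.inr hu)
          simp only [Tubing.colorCount, ht, hu, if_true, if_false, Multiset.card_replicate]
          omega)
      have h₂ := ncard_universalTubes_sdiff_pos T
      rw [Multiset.card_add, Multiset.card_replicate]
      omega
    · classical
      have := Fintype.ofFinite V
      intro x hx
      rw [finsum_eq_sum_of_fintype, Multiset.mem_add, Multiset.mem_sum] at hx
      rcases hx with ⟨t, -, hx⟩ | hx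
      · exact Multiset.eq_of_mem_replicate hx
      · exact Multiset.eq_of_mem_replicate hx

variable {a : C} {P : Multiset C}

/-- With a single color only the sizes of the blocks matter, and these are prescribed by the tubing.
-/
theorem Template.tubing_injective_of_monochrome (hP : ∀ x ∈ P, x = a) {A B : Template G P}
    (h : A.tubing = B.tubing) : A = B := by
  refine Template.ext h (funext fun t => ?_) ?_
  · refine Blocks.eq_of_monochrome (a := a)
      (fun x hx => hP x (Multiset.mem_of_le (A.colors_le t) hx))
      (fun x hx => hP x (Multiset.mem_of_le (B.colors_le t) hx)) ?_ ?_
    · rw [A.length_ordered, B.length_ordered, h]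
    · rw [A.card_colors, B.card_colors, h]
  · rw [Multiset.eq_replicate_of_mem fun x hx => hP x (Multiset.mem_of_le A.universalBlock_le hx),
      Multiset.eq_replicate_of_mem fun x hx => hP x (Multiset.mem_of_le B.universalBlock_le hx)]
    congr 1
    have h₁ := A.card_universalBlock
    have h₂ := B.card_universalBlock
    rw [h] at h₁
    omega

/-- Every enlargement of the tubing by one tube is a step: the conditions on colors reduce to
conditions on sizes. These follow from the invariance of the other cores and from `ncard_core_add`.
-/
theorem addTube_of_monochrome (hP : ∀ x ∈ P, x = a) {A B : Template G P} {t : Set V}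
    (ht : t ∉ B.tubing.tubes) (hA : A.tubing.tubes = insert t B.tubing.tubes) : AddTube A B := by
  have hcol : ∀ (X : Template G P) t, ∀ x ∈ (X.blocks t).colors, x = a := fun X t x hx =>
    hP x (Multiset.mem_of_le (X.colors_le t) hx)
  have htA : t ∈ A.tubing.tubes := hA ▸ Or.inl rfl
  have hmem : ∀ {s}, s ≠ t → (s ∈ A.tubing.tubes ↔ s ∈ B.tubing.tubes) := by
    intro s hs
    rw [hA, Set.mem_insert_iff, or_iff_right hs]
  have hother : ∀ s, s ≠ t → (s ∈ B.tubing.all →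
      coreNodes A.tubing.tubes s = coreNodes B.tubing.tubes s ∧
      outerCount G A.tubing.tubes s = outerCount G B.tubing.tubes s) →
      A.blocks s = B.blocks s := by
    intro s hs h
    refine Blocks.eq_of_monochrome (hcol A s) (hcol B s) ?_ ?_
    · rw [A.length_ordered, B.length_ordered]
      unfold Tubing.orderedLength
      rw [hmem hs]
      split_ifs with h₁ h₂
      · rw [(h (Or.inl h₁)).2]
      · rw [(h (Or.inr h₂)).2]
      · rfl
    · rw [A.card_colors, B.card_colors]
      unfold Tubing.colorCount
      rw [hmem hs]
      split_ifs with h₁ h₂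
      · rw [(h (Or.inl h₁)).1]
      · rw [(h (Or.inr h₂)).1]
      · rfl
  refine ⟨t, ht, hA, ?_⟩
  by_cases hu : t ∈ universalTubes G
  · left
    have hins : (A.tubing.tubes ∩ universalTubes G).ncard =
        (B.tubing.tubes ∩ universalTubes G).ncard + 1 := by
      rw [hA, Set.insert_inter_of_mem hu, Set.ncard_insert_of_notMem (fun h => ht h.1)]
    have h₁ := A.card_universalBlock
    have h₂ := B.card_universalBlock
    have hself := core_eq_of_not_ssubset ht hA (ssubset_irrefl t)
    refine ⟨hu, fun s hs => hother s hs fun hsB => core_eq_of_not_ssubset ht hA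
      (not_ssubset_of_universal hu (B.tubing.connected hsB).preconnected), a, ?_, ?_⟩
    · refine Blocks.eq_of_monochrome (hcol A t) ?_ ?_ ?_
      · intro x hx
        rw [Blocks.colors, ← Multiset.cons_coe, Multiset.cons_add, Multiset.mem_cons] at hx
        exact hx.elim id (hcol B t x)
      · rw [A.ordered_tube t htA, List.length_cons, B.ordered_universal t hu ht, hself.2,
          add_comm]
      · rw [A.card_colors, Blocks.colors, ← Multiset.cons_coe, Multiset.cons_add,
          Multiset.card_cons, ← Blocks.colors, B.card_colors]
        have := outerCount_add_one_le A.tubing (t := t) (Or.inl htA)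
        simp only [Tubing.colorCount, htA, ht, hu, if_true, if_false, ← hself.1]
        omega
    · rw [Multiset.eq_replicate_of_mem fun x hx =>
          hP x (Multiset.mem_of_le A.universalBlock_le hx),
        Multiset.eq_replicate_of_mem fun x hx => hP x (Multiset.mem_of_le B.universalBlock_le hx),
        ← Multiset.replicate_succ]
      congr 1
      omega
  · right
    obtain ⟨r, hr⟩ := B.tubing.exists_isLeast (A.tubing.isTube t htA).2 hu
    have hrt : r ≠ t := hr.1.2.ne'
    refine ⟨hu, ?_, r, hr, fun s hst hsr => hother s hst fun hsB =>
      core_eq_of_ne ht hA hr hsB hsr, _, _, Blocks.isLinearization_replicate (hcol A r),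
      Blocks.isLinearization_replicate (hcol A t), ?_⟩
    · rw [Multiset.eq_replicate_of_mem fun x hx =>
          hP x (Multiset.mem_of_le A.universalBlock_le hx),
        Multiset.eq_replicate_of_mem fun x hx => hP x (Multiset.mem_of_le B.universalBlock_le hx)]
      congr 1
      have h₁ := A.card_universalBlock
      have h₂ := B.card_universalBlock
      rw [hA, Set.insert_inter_of_notMem hu] at h₁
      omega
    · rw [← List.replicate_add]
      convert Blocks.isLinearization_replicate (hcol B r) using 2
      rw [A.card_colors, A.card_colors, B.card_colors]
      have hadd := ncard_core_add ht hA hr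
      unfold Tubing.colorCount
      have hrA : r ∈ A.tubing.all := hr.1.1.imp_left (hmem hrt).2
      -- The new core of `r` is nonempty, so the color missing from an uncolored universal `r` is
      -- subtracted without truncation on both sides.
      have := outerCount_add_one_le A.tubing hrA
      rw [hmem hrt, if_pos htA]
      split_ifs with h₁ h₂
      · omega
      · omega
      · exact (hr.1.1.elim h₁ h₂).elim

/-- Every subset of a tubing is a tubing. So if `A` has all tubes of `B`, the missing ones can be
added to `B` one at a time, in any order, and each addition is a step. -/
theorem nonempty_orderIso_tubing_of_replicate (a : C) :
    Nonempty (Template G (Multiset.replicate (Nat.card V - 1) a) ≃o Tubing G) := by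
  have hP : ∀ x ∈ Multiset.replicate (Nat.card V - 1) a, x = a :=
    fun x hx => Multiset.eq_of_mem_replicate hx
  refine ⟨{ toFun := Template.tubing
            invFun := Template.const a
            left_inv := fun A => Template.tubing_injective_of_monochrome hP rfl
            right_inv := fun T => rfl
            map_rel_iff' := ?_ }⟩
  intro A B
  constructor
  · intro h
    have h : B.tubing.tubes ⊆ A.tubing.tubes := h
    induction hn : (A.tubing.tubes \ B.tubing.tubes).ncard generalizing B with
    | zero =>
      rw [Set.ncard_eq_zero (Set.toFinite _), Set.sdiff_eq_empty] at hn
      exact (Template.tubing_injective_of_monochrome hP (Tubing.ext (hn.antisymm h))).le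
    | succ n ih =>
      obtain ⟨t, htA, htB⟩ := (Set.ncard_pos (Set.toFinite _)).1 (by rw [hn]; exact n.succ_pos)
      have hsub : insert t B.tubing.tubes ⊆ A.tubing.tubes := Set.insert_subset htA h
      let X := Template.const a (A.tubing.restrict _ hsub)
      have hX : AddTube X B := addTube_of_monochrome hP htB rfl
      refine Relation.ReflTransGen.tail (ih (B := X) hsub hsub ?_) hX
      have : A.tubing.tubes \ X.tubing.tubes = (A.tubing.tubes \ B.tubing.tubes) \ {t} := by
        rw [Set.sdiff_sdiff, Set.union_singleton]; rfl
      have hmem : t ∈ A.tubing.tubes \ B.tubing.tubes := ⟨htA, htB⟩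
      rw [this, Set.ncard_sdiff_singleton_of_mem hmem, hn]
      rfl
  · intro h
    change B.tubing.tubes ⊆ A.tubing.tubes
    rcases eq_or_ssubset_of_reflTransGen h with rfl | h
    · exact Set.Subset.rfl
    · exact h.1

/-- With a monochrome palette, a template is determined by its tubing. -/
theorem nonempty_orderIso_tubing (hP : ∀ x ∈ P, ∀ y ∈ P, x = y) (hcard : P.card + 1 = Nat.card V) :
    Nonempty (Template G P ≃o Tubing G) := by
  -- Without any color the palette is empty, and there is nothing to build a constant template from;
  -- renaming into a one-color type supplies a color.
  rcases isEmpty_or_nonempty C with hC | ⟨⟨c⟩⟩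
  · obtain ⟨φ⟩ := nonempty_orderIso_tubing_of_replicate (G := G) ()
    have hmap : P.map (fun _ => ()) = Multiset.replicate (Nat.card V - 1) () := by
      refine Multiset.eq_replicate.2 ⟨?_, fun _ _ => rfl⟩
      rw [Multiset.card_map]
      omega
    exact ⟨(Template.mapOrderIso (fun x => isEmptyElim x) hmap).trans φ⟩
  · have : ∃ a, P = Multiset.replicate (Nat.card V - 1) a := by
      rcases P.empty_or_exists_mem with rfl | ⟨a, ha⟩
      · refine ⟨c, ?_⟩
        rw [← hcard]
        rfl
      · exact ⟨a, Multiset.eq_replicate.2 ⟨by omega, fun x hx => hP x hx a ha⟩⟩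
    obtain ⟨a, rfl⟩ := this
    exact nonempty_orderIso_tubing_of_replicate a

end Monochrome
/-! ### Subsets of components -/

section Ambient
variable {V : Type*} {G : SimpleGraph V} {c d : G.ConnectedComponent}

/-- A set of nodes of a component as a set of nodes of the whole graph. -/
def ambient (c : G.ConnectedComponent) (s : Set c) : Set V := Subtype.val '' s

theorem ambient_subset_supp (s : Set c) : ambient c s ⊆ c.supp := by
  rintro _ ⟨x, -, rfl⟩
  exact x.2

theorem ambient_univ : ambient c Set.univ = c.supp := by
  ext v
  exact ⟨fun h => ambient_subset_supp _ h, fun h => ⟨⟨v, h⟩, trivial, rfl⟩⟩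

theorem ambient_injective : Function.Injective (ambient c) :=
  Subtype.val_injective.image_injective

theorem ambient_subset_ambient {s r : Set c} : ambient c s ⊆ ambient c r ↔ s ⊆ r :=
  Set.image_subset_image_iff Subtype.val_injective

theorem ambient_ssubset_ambient {s r : Set c} : ambient c s ⊂ ambient c r ↔ s ⊂ r :=
  and_congr ambient_subset_ambient (not_congr ambient_subset_ambient)

theorem ambient_nonempty {s : Set c} : (ambient c s).Nonempty ↔ s.Nonempty :=
  Set.image_nonempty

theorem exists_ambient_eq {t : Set V} (ht : t ⊆ c.supp) : ∃ s : Set c, ambient c s = t := by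
  refine ⟨Subtype.val ⁻¹' t, ?_⟩
  ext v
  constructor
  · rintro ⟨x, hx, rfl⟩; exact hx
  · intro hv; exact ⟨⟨v, ht hv⟩, hv, rfl⟩

theorem eq_of_mem_ambient {s : Set c} {r : Set d} {v : V} (hs : v ∈ ambient c s)
    (hr : v ∈ ambient d r) : c = d :=
  SimpleGraph.ConnectedComponent.eq_of_common_vertex (ambient_subset_supp _ hs)
    (ambient_subset_supp _ hr)

theorem eq_of_ambient_eq {s : Set c} {r : Set d} (hs : s.Nonempty)
    (h : ambient c s = ambient d r) : c = d := by
  obtain ⟨v, hv⟩ := ambient_nonempty.2 hs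
  exact eq_of_mem_ambient hv (h ▸ hv)

theorem ambient_mem_universalTubes {s : Set c} (hs : s.Nonempty) :
    ambient c s ∈ universalTubes G ↔ s = Set.univ := by
  constructor
  · rintro ⟨d, hd⟩
    have hd : d.supp = ambient c s := hd
    have : c = d := eq_of_ambient_eq (r := Set.univ) hs (by rw [ambient_univ, hd])
    subst this
    rw [← ambient_univ] at hd
    exact (ambient_injective hd).symm
  · rintro rfl
    rw [ambient_univ]
    exact supp_mem_universalTubes c

theorem connected_induce_ambient {s : Set c} :
    (G.induce (ambient c s)).Connected ↔ (c.toSimpleGraph.induce s).Connected := by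
  let φ : c.toSimpleGraph.induce s ≃g G.induce (ambient c s) :=
    { toEquiv := Equiv.Set.image _ s Subtype.val_injective
      map_rel_iff' := fun {x y} => Iff.rfl }
  exact φ.connected_iff.symm

theorem compatible_ambient {s r : Set c} :
    Compatible G (ambient c s) (ambient c r) ↔ Compatible c.toSimpleGraph s r := by
  unfold Compatible
  rw [ambient_ssubset_ambient, ambient_ssubset_ambient]
  refine or_congr_right (or_congr_right (and_congr ?_ ?_))
  · exact Set.disjoint_image_iff Subtype.val_injective
  · constructor
    · intro h x hx y hy hxy
      exact h x ⟨x, hx, rfl⟩ y ⟨y, hy, rfl⟩ hxy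
    · rintro h _ ⟨x, hx, rfl⟩ _ ⟨y, hy, rfl⟩ hxy
      exact h x hx y hy hxy

theorem compatible_ambient_of_ne (hcd : c ≠ d) (s : Set c) (r : Set d) :
    Compatible G (ambient c s) (ambient d r) := by
  refine Or.inr (Or.inr ⟨Set.disjoint_left.2 fun v hs hr => hcd (eq_of_mem_ambient hs hr), ?_⟩)
  intro x hx y hy hxy
  exact hcd (SimpleGraph.ConnectedComponent.eq_of_common_vertex
    (c.mem_supp_of_adj_mem_supp (ambient_subset_supp _ hx) hxy) (ambient_subset_supp _ hy))

/-- Cores inside a component can be computed in the component. -/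
theorem core_ambient {T : Set (Set V)} {S : Set (Set c)}
    (h : ∀ r : Set c, r ≠ Set.univ → (ambient c r ∈ T ↔ r ∈ S)) (s : Set c) :
    coreNodes T (ambient c s) = ambient c (coreNodes S s) ∧
      outerCount G T (ambient c s) = outerCount c.toSimpleGraph S s := by
  -- Only proper subsets of the component lie strictly inside `ambient c s`, so it does not matter
  -- whether the component itself belongs to `T`.
  have hT : ∀ t ∈ T, t ⊂ ambient c s → ∃ r ∈ S, r ⊂ s ∧ ambient c r = t := by
    intro t ht hts
    obtain ⟨r, rfl⟩ := exists_ambient_eq (hts.1.trans (ambient_subset_supp s))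
    rw [ambient_ssubset_ambient] at hts
    exact ⟨r, (h r (ne_top_of_lt hts)).1 ht, hts, rfl⟩
  have hS : ∀ r ∈ S, r ⊂ s → ambient c r ∈ T ∧ ambient c r ⊂ ambient c s := fun r hr hrs =>
    ⟨(h r (ne_top_of_lt hrs)).2 hr, ambient_ssubset_ambient.2 hrs⟩
  have hcore : coreNodes T (ambient c s) = ambient c (coreNodes S s) := by
    ext v
    constructor
    · rintro ⟨⟨x, hx, rfl⟩, hv⟩
      exact ⟨x, ⟨hx, fun r hr hrs hxr => hv _ (hS r hr hrs).1 (hS r hr hrs).2 ⟨x, hxr, rfl⟩⟩, rfl⟩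
    · rintro ⟨x, ⟨hx, hv⟩, rfl⟩
      refine ⟨⟨x, hx, rfl⟩, fun t ht hts hxt => ?_⟩
      obtain ⟨r, hr, hrs, rfl⟩ := hT t ht hts
      obtain ⟨y, hy, hyx⟩ := hxt
      exact hv r hr hrs (Subtype.ext hyx ▸ hy)
  refine ⟨hcore, outerCount_congr Subtype.val Subtype.val_injective hcore ?_⟩
  intro x y hx hy hx' hy'
  simp only [coreGraph, ne_eq, Subtype.mk.injEq, Subtype.val_inj]
  refine and_congr_right fun _ => or_congr Iff.rfl ⟨?_, ?_⟩
  · rintro ⟨t, ht, hts, ⟨a, ha, hxa⟩, ⟨b, hb, hyb⟩⟩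
    obtain ⟨r, hr, hrs, rfl⟩ := hT t ht hts
    obtain ⟨a, ha, rfl⟩ := ha
    obtain ⟨b, hb, rfl⟩ := hb
    exact ⟨r, hr, hrs, ⟨a, ha, hxa⟩, ⟨b, hb, hyb⟩⟩
  · rintro ⟨r, hr, hrs, ⟨a, ha, hxa⟩, ⟨b, hb, hyb⟩⟩
    exact ⟨_, (hS r hr hrs).1, (hS r hr hrs).2, ⟨a, ⟨a, ha, rfl⟩, hxa⟩, ⟨b, ⟨b, hb, rfl⟩, hyb⟩⟩

theorem universalTubes_toSimpleGraph (c : G.ConnectedComponent) :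
    universalTubes c.toSimpleGraph = {Set.univ} :=
  universalTubes_of_connected c.connected_toSimpleGraph

theorem univ_notMem_tubes {W : Type*} {H : SimpleGraph W} (T : Tubing H) :
    Set.univ ∉ T.tubes := fun h => (T.isTube _ h).1 rfl

theorem Tubing.nonempty_of_mem {W : Type*} {H : SimpleGraph W} (T : Tubing H) {t : Set W}
    (ht : t ∈ T.tubes) : t.Nonempty := T.nonempty (Or.inl ht)

theorem component_univ_nonempty (c : G.ConnectedComponent) : (Set.univ : Set c).Nonempty := by
  obtain ⟨v, hv⟩ := c.nonempty_supp
  exact ⟨⟨v, hv⟩, trivial⟩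

end Ambient

/-! ### Null graphs -/

section Null
variable {I : Type*}

theorem universalTubes_bot :
    universalTubes (⊥ : SimpleGraph I) = Set.range fun i : I => ({i} : Set I) := by
  have key : ∀ i, ((⊥ : SimpleGraph I).connectedComponentMk i).supp = {i} := by
    intro i
    ext j
    simp [SimpleGraph.ConnectedComponent.mem_supp_iff]
  ext t
  constructor
  · rintro ⟨c, rfl⟩
    obtain ⟨i, rfl⟩ := c.exists_rep
    exact ⟨i, (key i).symm⟩
  · rintro ⟨i, rfl⟩
    exact ⟨_, key i⟩

theorem singleton_mem_universalTubes_bot (i : I) :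
    ({i} : Set I) ∈ universalTubes (⊥ : SimpleGraph I) := by
  rw [universalTubes_bot]; exact ⟨i, rfl⟩

theorem exists_eq_singleton_of_mem_tubes (T : Tubing (⊥ : SimpleGraph I)) {t : Set I} (ht : t ∈ T.tubes) :
    ∃ i, t = {i} := by
  obtain ⟨v⟩ := (T.isTube t ht).2.nonempty
  refine ⟨v, Set.Subset.antisymm ?_ (by simp)⟩
  have h := subset_supp_of_mem (T.isTube t ht).2.preconnected v.2
    (c := (⊥ : SimpleGraph I).connectedComponentMk v) rfl
  have := supp_mem_universalTubes ((⊥ : SimpleGraph I).connectedComponentMk v)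
  rw [universalTubes_bot] at this
  obtain ⟨i, hi⟩ := this
  have hv : v.1 ∈ ((⊥ : SimpleGraph I).connectedComponentMk v).supp := rfl
  rw [← hi] at h hv
  rw [Set.mem_singleton_iff] at hv
  rwa [hv]

theorem isTube_bot_singleton {i : I} (h : ({i} : Set I) ≠ Set.univ) :
    IsTube (⊥ : SimpleGraph I) {i} :=
  ⟨h, connected_induce_of_mem_universalTubes (singleton_mem_universalTubes_bot i)⟩

theorem coreNodes_bot (T : Tubing (⊥ : SimpleGraph I)) (i : I) :
    coreNodes T.tubes {i} = {i} := by
  ext v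
  refine ⟨fun h => h.1, fun h => ⟨h, fun s hs hsi => ?_⟩⟩
  rw [Set.ssubset_singleton_iff] at hsi
  exact (((T.nonempty_of_mem hs).ne_empty) hsi).elim

theorem outerCount_bot [Finite I] (T : Tubing (⊥ : SimpleGraph I)) (i : I) :
    outerCount ⊥ T.tubes {i} = 0 := by
  have := outerCount_add_one_le T (Or.inr (singleton_mem_universalTubes_bot i))
  rw [coreNodes_bot, Set.ncard_singleton] at this
  omega

variable {C : Type*} {P : Multiset C}

theorem blocks_bot_eq_empty (A : Template (⊥ : SimpleGraph I) P) {t : Set I}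
    (h : ∀ i, t ≠ {i}) : A.blocks t = ⟨[], 0⟩ := by
  refine A.blocks_eq_empty t (fun ht => ?_) fun ht => ?_
  · obtain ⟨i, hi⟩ := exists_eq_singleton_of_mem_tubes A.tubing ht
    exact h i hi
  · rw [universalTubes_bot] at ht
    obtain ⟨i, rfl⟩ := ht
    exact h i rfl

theorem length_blocks_bot_of_mem [Finite I] (A : Template (⊥ : SimpleGraph I) P) {i : I}
    (h : {i} ∈ A.tubing.tubes) : (A.blocks {i}).ordered.length = 1 := by
  rw [A.ordered_tube _ h, outerCount_bot]

theorem length_blocks_bot_of_notMem [Finite I] (A : Template (⊥ : SimpleGraph I) P) {i : I}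
    (h : {i} ∉ A.tubing.tubes) : (A.blocks {i}).ordered.length = 0 := by
  rw [A.ordered_universal _ (singleton_mem_universalTubes_bot i) h, outerCount_bot]

/-- A core with one node has room for one color, which is the color of the tube if the tube is
present; otherwise there is no color at all. -/
theorem inner_blocks_bot [Finite I] (A : Template (⊥ : SimpleGraph I) P) (i : I) :
    (A.blocks {i}).inner = 0 := by
  rw [← Multiset.card_eq_zero]
  by_cases h : {i} ∈ A.tubing.tubes
  · have := A.inner_tube _ h
    rw [length_blocks_bot_of_mem A h, coreNodes_bot, Set.ncard_singleton] at this
    omega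
  · have := A.inner_universal _ (singleton_mem_universalTubes_bot i) h
    rw [coreNodes_bot, Set.ncard_singleton] at this
    omega

theorem finsum_eq_sum_singleton [Fintype I] (b : Set I → Multiset C)
    (h : ∀ t, (∀ i, t ≠ {i}) → b t = 0) : ∑ᶠ t, b t = ∑ i, b {i} := by
  classical
  rw [finsum_eq_sum_of_fintype]
  symm
  refine Finset.sum_of_injOn (fun i => {i}) (fun i _ j _ hij => Set.singleton_injective hij)
    (fun _ _ => Finset.mem_coe.2 (Finset.mem_univ _)) (fun t _ ht => h t ?_) fun _ _ => rfl
  rintro i rfl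
  exact ht ⟨i, by simp, rfl⟩

end Null
/-! ### Decomposition of tubings -/

section Decomposition
variable {V : Type*} {G : SimpleGraph V} {m : ℕ} {e : Fin m ≃ G.ConnectedComponent}

/-- The empty set is the only set of nodes that comes from several components. -/
theorem ambient_sigma_eq {i j : Fin m} {s : Set (e i)} {r : Set (e j)} (hs : s.Nonempty)
    (h : ambient (e i) s = ambient (e j) r) : (⟨i, s⟩ : Σ i, Set (e i)) = ⟨j, r⟩ := by
  obtain rfl : i = j := e.injective (eq_of_ambient_eq hs h)
  rw [ambient_injective h]

theorem exists_ambient_eq_of_connected (e : Fin m ≃ G.ConnectedComponent) {t : Set V}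
    (ht : (G.induce t).Connected) :
    ∃ (i : Fin m) (s : Set (e i)), s.Nonempty ∧ ambient (e i) s = t := by
  obtain ⟨v⟩ := ht.nonempty
  obtain ⟨i, hi⟩ := e.surjective (G.connectedComponentMk v)
  obtain ⟨s, rfl⟩ := exists_ambient_eq (c := e i)
    (subset_supp_of_mem ht.preconnected v.2 (by rw [hi]; rfl))
  exact ⟨i, s, ambient_nonempty.1 ⟨v, v.2⟩, rfl⟩

/-- The tubing `T` of `G` consists of the tubings `S i` of the components and of the components
selected by the tubing `S₀` of the null graph. -/
structure IsTubingJoin (T : Tubing G) (S : ∀ i, Tubing (e i).toSimpleGraph)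
    (S₀ : Tubing (⊥ : SimpleGraph (Fin m))) : Prop where
  mem_iff : ∀ i (s : Set (e i)), s ≠ Set.univ → (ambient (e i) s ∈ T.tubes ↔ s ∈ (S i).tubes)
  supp_mem_iff : ∀ i, ambient (e i) Set.univ ∈ T.tubes ↔ {i} ∈ S₀.tubes

/-- Sets in different components are always compatible, and a tube of a component lies properly
inside it. The condition that not all components occur is the one satisfied by `S₀`. -/
theorem exists_tubingJoin (S : ∀ i, Tubing (e i).toSimpleGraph)
    (S₀ : Tubing (⊥ : SimpleGraph (Fin m))) : ∃ T : Tubing G, IsTubingJoin T S S₀ := by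
  let U : Set (Set V) := {t | (∃ i, ∃ s ∈ (S i).tubes, ambient (e i) s = t) ∨
    ∃ i, {i} ∈ S₀.tubes ∧ ambient (e i) Set.univ = t}
  have hU₁ : ∀ i (s : Set (e i)), s ≠ Set.univ → (ambient (e i) s ∈ U ↔ s ∈ (S i).tubes) := by
    intro i s hs
    constructor
    · rintro (⟨j, r, hr, h⟩ | ⟨j, hj, h⟩)
      · have := ambient_sigma_eq ((S j).nonempty_of_mem hr) h
        cases this
        exact hr
      · have := ambient_sigma_eq (component_univ_nonempty _) h
        cases this
        exact (hs rfl).elim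
    · intro h
      exact Or.inl ⟨i, s, h, rfl⟩
  have hU₂ : ∀ i, ambient (e i) Set.univ ∈ U ↔ {i} ∈ S₀.tubes := by
    intro i
    constructor
    · rintro (⟨j, r, hr, h⟩ | ⟨j, hj, h⟩)
      · have := ambient_sigma_eq ((S j).nonempty_of_mem hr) h
        cases this
        exact (univ_notMem_tubes _ hr).elim
      · have := ambient_sigma_eq (component_univ_nonempty _) h
        cases this
        exact hj
    · intro h
      exact Or.inr ⟨i, h, rfl⟩
  refine ⟨⟨U, ?_, ?_, ?_⟩, hU₁, hU₂⟩
  · rintro _ (⟨i, s, hs, rfl⟩ | ⟨i, hi, rfl⟩)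
    · refine ⟨fun h => ?_, connected_induce_ambient.2 ((S i).isTube s hs).2⟩
      refine ((S i).isTube s hs).1 (Set.eq_univ_of_forall fun x => ?_)
      have hx : x.1 ∈ ambient (e i) s := h ▸ trivial
      obtain ⟨y, hy, hyx⟩ := hx
      exact Subtype.ext hyx ▸ hy
    -- If one component were all of `V`, it would be the only one, and `{i}` would not be proper in
    -- the null graph.
    · refine ⟨fun h => (S₀.isTube _ hi).1 (Set.eq_univ_of_forall fun j => ?_), ?_⟩
      · obtain ⟨v, hv⟩ := ambient_nonempty.2 (component_univ_nonempty (e j))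
        exact e.injective (eq_of_mem_ambient hv
          (show v ∈ ambient (e i) Set.univ from h ▸ trivial))
      · rw [ambient_univ]
        exact connected_induce_of_mem_universalTubes (supp_mem_universalTubes _)
  · have hcross : ∀ i (s : Set (e i)) j (r : Set (e j)), i ≠ j →
        Compatible G (ambient (e i) s) (ambient (e j) r) := fun i s j r hij =>
      compatible_ambient_of_ne (e.injective.ne hij) s r
    rintro _ (⟨i, s, hs, rfl⟩ | ⟨i, hi, rfl⟩) _ (⟨j, r, hr, rfl⟩ | ⟨j, hj, rfl⟩) hne
    · by_cases hij : i = j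
      · subst hij
        exact compatible_ambient.2 ((S i).compatible hs hr (fun h => hne (h ▸ rfl)))
      · exact hcross _ _ _ _ hij
    · by_cases hij : i = j
      · subst hij
        exact Or.inl (ambient_ssubset_ambient.2 ((S i).isTube s hs).1.lt_top)
      · exact hcross _ _ _ _ hij
    · by_cases hij : i = j
      · subst hij
        exact Or.inr (Or.inl (ambient_ssubset_ambient.2 ((S i).isTube r hr).1.lt_top))
      · exact hcross _ _ _ _ hij
    · by_cases hij : i = j
      · subst hij
        exact (hne rfl).elim
      · exact hcross _ _ _ _ hij
  · intro h
    refine S₀.not_all ?_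
    rw [universalTubes_bot]
    rintro _ ⟨i, rfl⟩
    refine (hU₂ i).1 (h ?_)
    rw [ambient_univ]
    exact supp_mem_universalTubes _

/-- The full node set of a component is left out of `S i`, where it is not a proper subset; whether
it is a tube of `T` is recorded by `S₀` instead. -/
theorem exists_tubingSplit (e : Fin m ≃ G.ConnectedComponent) (T : Tubing G) :
    ∃ (S : ∀ i, Tubing (e i).toSimpleGraph) (S₀ : Tubing (⊥ : SimpleGraph (Fin m))),
      IsTubingJoin T S S₀ := by
  refine ⟨fun i =>
    { tubes := {s | s ≠ Set.univ ∧ ambient (e i) s ∈ T.tubes}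
      isTube := fun s hs => ⟨hs.1, connected_induce_ambient.1 (T.isTube _ hs.2).2⟩
      compatible := fun s hs r hr hsr => compatible_ambient.1
        (T.compatible hs.2 hr.2 (ambient_injective.ne hsr))
      not_all := ?_ },
    { tubes := {t | ∃ i, t = {i} ∧ ambient (e i) Set.univ ∈ T.tubes}
      isTube := ?_
      compatible := ?_
      not_all := ?_ }, fun i s hs => ?_, fun i => ?_⟩
  · intro h
    rw [universalTubes_toSimpleGraph] at h
    exact (h rfl).1 rfl
  · rintro _ ⟨i, rfl, hi⟩
    refine isTube_bot_singleton fun h => (T.isTube _ hi).1 (Set.eq_univ_of_forall fun v => ?_)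
    have : e.symm (G.connectedComponentMk v) ∈ ({i} : Set (Fin m)) := h ▸ trivial
    rw [Set.mem_singleton_iff, Equiv.symm_apply_eq] at this
    rw [ambient_univ, ← this]
    rfl
  · rintro _ ⟨i, rfl, -⟩ _ ⟨j, rfl, -⟩ hij
    refine Or.inr (Or.inr ⟨?_, fun x _ y _ h => h⟩)
    rw [Set.disjoint_singleton]
    rintro rfl
    exact hij rfl
  · intro h
    refine T.not_all ?_
    rintro _ ⟨c, rfl⟩
    obtain ⟨i, rfl⟩ := e.surjective c
    obtain ⟨j, hij, hj⟩ := h (singleton_mem_universalTubes_bot i)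
    rw [Set.singleton_eq_singleton_iff] at hij
    subst hij
    rwa [ambient_univ] at hj
  · exact ⟨fun h => ⟨hs, h⟩, fun h => h.2⟩
  · constructor
    · intro h
      exact ⟨i, rfl, h⟩
    · rintro ⟨j, hij, hj⟩
      rw [Set.singleton_eq_singleton_iff] at hij
      subst hij
      exact hj

section
variable {T : Tubing G} {S : ∀ i, Tubing (e i).toSimpleGraph}
  {S₀ : Tubing (⊥ : SimpleGraph (Fin m))}

theorem IsTubingJoin.core (h : IsTubingJoin T S S₀) (i : Fin m) (s : Set (e i)) :
    (coreNodes T.tubes (ambient (e i) s)).ncard = (coreNodes (S i).tubes s).ncard ∧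
      outerCount G T.tubes (ambient (e i) s) = outerCount (e i).toSimpleGraph (S i).tubes s := by
  obtain ⟨h₁, h₂⟩ := core_ambient (h.mem_iff i) s
  exact ⟨by rw [h₁]; exact Set.ncard_image_of_injective _ Subtype.val_injective, h₂⟩

theorem IsTubingJoin.mem_tubes_iff (h : IsTubingJoin T S S₀) {i : Fin m} {s : Set (e i)} :
    ambient (e i) s ∈ T.tubes ↔ s ∈ (S i).tubes ∨ s = Set.univ ∧ {i} ∈ S₀.tubes := by
  by_cases hs : s = Set.univ
  · subst hs
    rw [h.supp_mem_iff]
    simp [univ_notMem_tubes]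
  · simp [h.mem_iff i s hs, hs]

/-- `S₀` does not enter, because a component counts as a universal tube on both sides whether or not
it is in the tubing. -/
theorem IsTubingJoin.mem_all_iff (h : IsTubingJoin T S S₀) {i : Fin m} {s : Set (e i)}
    (hs : s.Nonempty) : ambient (e i) s ∈ T.all ↔ s ∈ (S i).all := by
  unfold Tubing.all
  rw [Set.mem_union, Set.mem_union, ambient_mem_universalTubes hs, universalTubes_toSimpleGraph,
    h.mem_tubes_iff, Set.mem_singleton_iff]
  tauto

theorem supp_injective_of_equiv (e : Fin m ≃ G.ConnectedComponent) :
    Function.Injective fun i => (e i).supp :=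
  SimpleGraph.ConnectedComponent.supp_injective.comp e.injective

theorem ncard_universalTubes (e : Fin m ≃ G.ConnectedComponent) :
    (universalTubes G).ncard = m := by
  have : universalTubes G = (fun i => (e i).supp) '' Set.univ := by
    ext t
    constructor
    · rintro ⟨c, rfl⟩
      exact ⟨e.symm c, trivial, by simp⟩
    · rintro ⟨i, -, rfl⟩
      exact ⟨_, rfl⟩
  rw [this, Set.ncard_image_of_injective _ (supp_injective_of_equiv e), Set.ncard_univ]
  simp

theorem ncard_universalTubes_bot :
    (universalTubes (⊥ : SimpleGraph (Fin m))).ncard = m := by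
  rw [universalTubes_bot, ← Set.image_univ, Set.ncard_image_of_injective _ Set.singleton_injective,
    Set.ncard_univ]
  simp

theorem ncard_tubes_inter_bot (S₀ : Tubing (⊥ : SimpleGraph (Fin m))) :
    (S₀.tubes ∩ universalTubes (⊥ : SimpleGraph (Fin m))).ncard =
      {i : Fin m | {i} ∈ S₀.tubes}.ncard := by
  have h : S₀.tubes ∩ universalTubes (⊥ : SimpleGraph (Fin m)) =
      (fun i => {i}) '' {i : Fin m | {i} ∈ S₀.tubes} := by
    rw [universalTubes_bot]
    ext t
    constructor
    · rintro ⟨ht, ⟨i, rfl⟩⟩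
      exact ⟨i, ht, rfl⟩
    · rintro ⟨i, hi, rfl⟩
      exact ⟨hi, i, rfl⟩
  rw [h, Set.ncard_image_of_injective _ Set.singleton_injective]

theorem IsTubingJoin.ncard_inter (h : IsTubingJoin T S S₀) :
    (T.tubes ∩ universalTubes G).ncard =
      (S₀.tubes ∩ universalTubes (⊥ : SimpleGraph (Fin m))).ncard := by
  have h₁ : T.tubes ∩ universalTubes G = (fun i => (e i).supp) '' {i | {i} ∈ S₀.tubes} := by
    ext t
    constructor
    · rintro ⟨ht, ⟨c, rfl⟩⟩
      obtain ⟨i, rfl⟩ := e.surjective c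
      refine ⟨i, (h.supp_mem_iff i).1 ?_, rfl⟩
      rwa [ambient_univ]
    · rintro ⟨i, hi, rfl⟩
      refine ⟨?_, supp_mem_universalTubes _⟩
      have := (h.supp_mem_iff i).2 hi
      rwa [ambient_univ] at this
  rw [h₁, ncard_tubes_inter_bot, Set.ncard_image_of_injective _ (supp_injective_of_equiv e)]

theorem ncard_universalTubes_toSimpleGraph_inter (i : Fin m) :
    ((S i).tubes ∩ universalTubes (e i).toSimpleGraph).ncard = 0 := by
  rw [universalTubes_toSimpleGraph, Set.inter_singleton_eq_empty.2 (univ_notMem_tubes _),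
    Set.ncard_empty]

end

/-! ### Decomposition of templates -/

/-- Put a list of ordered colors before some blocks. -/
def Blocks.prepend {C : Type*} (l : List C) (b : Blocks C) : Blocks C :=
  ⟨l ++ b.ordered, b.inner⟩

theorem Blocks.isLinearization_prepend {C : Type*} {l w : List C} {b : Blocks C} :
    (b.prepend l).IsLinearization w ↔ ∃ v, b.IsLinearization v ∧ w = l ++ v := by
  constructor
  · rintro ⟨k, hk, rfl⟩
    exact ⟨b.ordered ++ k, ⟨k, hk, rfl⟩, List.append_assoc _ _ _⟩
  · rintro ⟨_, ⟨k, hk, rfl⟩, rfl⟩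
    exact ⟨k, hk, (List.append_assoc _ _ _).symm⟩

theorem Blocks.colors_prepend {C : Type*} {l : List C} {b : Blocks C} :
    (b.prepend l).colors = b.colors + l := by
  simp only [Blocks.colors, Blocks.prepend, ← Multiset.coe_add]
  abel

theorem Blocks.prepend_inj {C : Type*} {l l' : List C} {b b' : Blocks C}
    (h : b.prepend l = b'.prepend l') (hl : l.length = l'.length) : l = l' ∧ b = b' := by
  obtain ⟨h₁, h₂⟩ := List.append_inj (congrArg Blocks.ordered h) hl
  have h₃ := congrArg Blocks.inner h
  exact ⟨h₁, Blocks.ext h₂ h₃⟩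

variable {C : Type*} {P : Multiset C} {Q : Fin m → Multiset C} {Q₀ : Multiset C}

open Classical in
/-- The colors of the universal tubes in a template of the null graph, as colors to be put
before the blocks of the components. -/
noncomputable def tubeColor (e : Fin m ≃ G.ConnectedComponent)
    (X₀ : Template (⊥ : SimpleGraph (Fin m)) Q₀) (i : Fin m) (s : Set (e i)) : List C :=
  if s = Set.univ then (X₀.blocks {i}).ordered else []

/-- The template `A` of `G` is composed of the templates `X i` of the components and the
template `X₀` of the null graph. -/
structure IsJoin (A : Template G P) (X : ∀ i, Template (e i).toSimpleGraph (Q i))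
    (X₀ : Template (⊥ : SimpleGraph (Fin m)) Q₀) : Prop where
  tubing : IsTubingJoin A.tubing (fun i => (X i).tubing) X₀.tubing
  blocks : ∀ i (s : Set (e i)), s.Nonempty →
    A.blocks (ambient (e i) s) = ((X i).blocks s).prepend (tubeColor e X₀ i s)
  universalBlock : A.universalBlock = X₀.universalBlock

theorem Template.universalBlock_eq_zero {i : Fin m} {R : Multiset C}
    (X : Template (e i).toSimpleGraph R) : X.universalBlock = 0 := by
  have := X.card_universalBlock
  rw [universalTubes_toSimpleGraph, Set.inter_singleton_eq_empty.2 (univ_notMem_tubes _),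
    Set.ncard_empty, Set.ncard_singleton] at this
  rw [← Multiset.card_eq_zero]
  omega

theorem Template.finsum_colors_eq {i : Fin m} {R : Multiset C}
    (X : Template (e i).toSimpleGraph R) : ∑ᶠ t, (X.blocks t).colors = R := by
  have := X.partition
  rwa [X.universalBlock_eq_zero, add_zero] at this

theorem blocks_empty_of_empty {W : Type*} {H : SimpleGraph W} (X : Template H P) :
    X.blocks ∅ = ⟨[], 0⟩ := by
  refine X.blocks_eq_empty ∅ (fun h => ?_) fun h => ?_
  · exact Set.not_nonempty_empty (X.tubing.nonempty (Or.inl h))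
  · exact Set.not_nonempty_empty (X.tubing.nonempty (Or.inr h))

/-- Nonempty sets of nodes of components inject into the sets of nodes of `G`, so the sum can be
regrouped by components. The extra terms `k i` are meant for the colors of the components as tubes
of `G`. -/
theorem finsum_ambient [Finite V] (b : Set V → Multiset C) (g : ∀ i, Set (e i) → Multiset C)
    (k : Fin m → Multiset C) (hb : ∀ i (s : Set (e i)), s.Nonempty → s ≠ Set.univ →
      b (ambient (e i) s) = g i s)
    (hu : ∀ i, b (ambient (e i) Set.univ) = g i Set.univ + k i) (hg : ∀ i, g i ∅ = 0)
    (h₀ : ∀ t, (∀ i (s : Set (e i)), s.Nonempty → ambient (e i) s ≠ t) → b t = 0) :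
    ∑ᶠ t, b t = ∑ i, ∑ᶠ s, g i s + ∑ i, k i := by
  classical
  have := Fintype.ofFinite V
  have : ∀ i, Fintype (e i) := fun i => Fintype.ofFinite _
  let F : (Σ i, Set (e i)) → Multiset C := fun x =>
    g x.1 x.2 + if x.2 = Set.univ then k x.1 else 0
  have hF : ∑ i, ∑ᶠ s, g i s + ∑ i, k i = ∑ x, F x := by
    rw [Fintype.sum_sigma, ← Finset.sum_add_distrib]
    refine Finset.sum_congr rfl fun i _ => ?_
    dsimp only [F]
    rw [finsum_eq_sum_of_fintype, Finset.sum_add_distrib, Finset.sum_ite_eq']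
    simp
  -- The empty sets are removed before reindexing: they all have the same image, and they contribute
  -- nothing.
  rw [hF, finsum_eq_sum_of_fintype,
    ← Finset.sum_filter_of_ne (p := fun x : Σ i, Set (e i) => x.2.Nonempty)]
  · symm
    refine Finset.sum_of_injOn (fun x => ambient (e x.1) x.2) ?_ ?_ ?_ ?_
    · intro x hx y hy hxy
      exact ambient_sigma_eq (by simpa using hx) hxy
    · exact fun _ _ => Finset.mem_coe.2 (Finset.mem_univ _)
    · intro t _ ht
      refine h₀ t fun i s hs hst => ht ⟨⟨i, s⟩, by simpa using hs, hst⟩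
    · rintro ⟨i, s⟩ hx
      have hs : s.Nonempty := by simpa using hx
      by_cases hsu : s = Set.univ
      · subst hsu
        simp [F, hu]
      · simp [F, hb i s hs hsu, hsu]
  · rintro ⟨i, s⟩ - hne
    by_contra hs
    replace hs : s = (∅ : Set (e i)) := Set.not_nonempty_iff_eq_empty.1 hs
    refine hne ?_
    subst hs
    have : (∅ : Set (e i)) ≠ Set.univ := (component_univ_nonempty _).ne_empty.symm
    simp [F, hg, this]

end Decomposition
-- Existence of joins and of splittings
section Join
variable {V : Type*} {G : SimpleGraph V} {m : ℕ} {e : Fin m ≃ G.ConnectedComponent}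
  {C : Type*} {P : Multiset C} {Q : Fin m → Multiset C} {Q₀ : Multiset C}

theorem length_tubeColor (X₀ : Template (⊥ : SimpleGraph (Fin m)) Q₀) (i : Fin m) :
    ({i} ∈ X₀.tubing.tubes → (tubeColor e X₀ i Set.univ).length = 1) ∧
    ({i} ∉ X₀.tubing.tubes → (tubeColor e X₀ i Set.univ).length = 0) := by
  rw [tubeColor, if_pos rfl]
  exact ⟨length_blocks_bot_of_mem X₀, length_blocks_bot_of_notMem X₀⟩

theorem tubeColor_of_ne (X₀ : Template (⊥ : SimpleGraph (Fin m)) Q₀) {i : Fin m} {s : Set (e i)}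
    (hs : s ≠ Set.univ) : tubeColor e X₀ i s = [] := if_neg hs

theorem Blocks.prepend_nil (b : Blocks C) : b.prepend [] = b := rfl

theorem colors_blocks_bot (X₀ : Template (⊥ : SimpleGraph (Fin m)) Q₀) (i : Fin m) :
    (X₀.blocks {i}).colors = (X₀.blocks {i}).ordered := by
  rw [Blocks.colors, inner_blocks_bot, add_zero]

theorem sum_blocks_bot (X₀ : Template (⊥ : SimpleGraph (Fin m)) Q₀) :
    ∑ i, ((X₀.blocks {i}).ordered : Multiset C) + X₀.universalBlock = Q₀ := by
  have h := X₀.partition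
  rw [finsum_eq_sum_singleton _ fun t ht => by rw [blocks_bot_eq_empty X₀ ht]; rfl] at h
  simpa only [colors_blocks_bot] using h

variable [Finite V]

/-- The color of `{i}` in `X₀` is put before the blocks of the component. Inside the component its
node set is universal and uncolored, so it is one color short of its core, and the prepended color
supplies exactly this one when the component is a tube of `G`. -/
theorem exists_join (X : ∀ i, Template (e i).toSimpleGraph (Q i))
    (X₀ : Template (⊥ : SimpleGraph (Fin m)) Q₀) (hP : ∑ i, Q i + Q₀ = P) :
    ∃ A : Template G P, IsJoin A X X₀ := by
  classical
  obtain ⟨T, hT⟩ := exists_tubingJoin (fun i => (X i).tubing) X₀.tubing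
  let F : (Σ i, Set (e i)) → Blocks C := fun x =>
    ((X x.1).blocks x.2).prepend (tubeColor e X₀ x.1 x.2)
  -- The representation of `t` by a nonempty set in a component is unique, so the choice is
  -- harmless.
  let b : Set V → Blocks C := fun t =>
    if h : ∃ x : Σ i, Set (e i), x.2.Nonempty ∧ ambient (e x.1) x.2 = t then F h.choose
    else ⟨[], 0⟩
  have hb : ∀ i (s : Set (e i)), s.Nonempty →
      b (ambient (e i) s) = ((X i).blocks s).prepend (tubeColor e X₀ i s) := by
    intro i s hs
    have h : ∃ x : Σ i, Set (e i), x.2.Nonempty ∧ ambient (e x.1) x.2 = ambient (e i) s :=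
      ⟨⟨i, s⟩, hs, rfl⟩
    have hx : h.choose = ⟨i, s⟩ := ambient_sigma_eq h.choose_spec.1 h.choose_spec.2
    have : b (ambient (e i) s) = F h.choose := dif_pos h
    rw [this, hx]
  have hb₀ : ∀ t, (∀ i (s : Set (e i)), s.Nonempty → ambient (e i) s ≠ t) → b t = ⟨[], 0⟩ := by
    intro t ht
    refine dif_neg ?_
    rintro ⟨⟨i, s⟩, hs, h⟩
    exact ht i s hs h
  have hlen : ∀ i (s : Set (e i)), s.Nonempty → (b (ambient (e i) s)).ordered.length =
      (tubeColor e X₀ i s).length + ((X i).blocks s).ordered.length := by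
    intro i s hs
    rw [hb i s hs, Blocks.prepend, List.length_append]
  have hin : ∀ i (s : Set (e i)), s.Nonempty →
      (b (ambient (e i) s)).inner = ((X i).blocks s).inner := by
    intro i s hs
    rw [hb i s hs, Blocks.prepend]
  refine ⟨⟨T, b, X₀.universalBlock, ?_, ?_, ?_, ?_, ?_, ?_, ?_⟩, hT, hb, rfl⟩
  · intro t h₁ h₂
    by_cases ht : ∃ i, ∃ s : Set (e i), s.Nonempty ∧ ambient (e i) s = t
    · obtain ⟨i, s, hs, rfl⟩ := ht
      rw [ambient_mem_universalTubes hs] at h₂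
      rw [hb i s hs, tubeColor_of_ne X₀ h₂, Blocks.prepend_nil]
      refine (X i).blocks_eq_empty s (fun h => h₁ ((hT.mem_iff i s h₂).2 h)) ?_
      rwa [universalTubes_toSimpleGraph]
    · push Not at ht
      exact hb₀ t ht
  · intro t ht
    obtain ⟨i, s, hs, rfl⟩ := exists_ambient_eq_of_connected e (T.isTube t ht).2
    rw [hlen i s hs, (hT.core i s).2]
    by_cases hsu : s = Set.univ
    · subst hsu
      rw [hT.supp_mem_iff] at ht
      rw [(length_tubeColor X₀ i).1 ht, (X i).ordered_universal _
        (by rw [universalTubes_toSimpleGraph]; rfl) (univ_notMem_tubes _)]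
    · rw [hT.mem_iff i s hsu] at ht
      rw [tubeColor_of_ne X₀ hsu, (X i).ordered_tube s ht]
      simp
  · intro t ht
    obtain ⟨i, s, hs, rfl⟩ := exists_ambient_eq_of_connected e (T.isTube t ht).2
    rw [hlen i s hs, hin i s hs, (hT.core i s).1]
    by_cases hsu : s = Set.univ
    · subst hsu
      rw [hT.supp_mem_iff] at ht
      rw [(length_tubeColor X₀ i).1 ht, ← (X i).inner_universal _
        (by rw [universalTubes_toSimpleGraph]; rfl) (univ_notMem_tubes _)]
      ring
    · rw [hT.mem_iff i s hsu] at ht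
      rw [tubeColor_of_ne X₀ hsu, ← (X i).inner_tube s ht]
      simp
  · intro t hu ht
    obtain ⟨i, s, hs, rfl⟩ :=
      exists_ambient_eq_of_connected e (connected_induce_of_mem_universalTubes hu)
    rw [ambient_mem_universalTubes hs] at hu
    subst hu
    rw [hT.supp_mem_iff] at ht
    rw [hlen i _ hs, (hT.core i _).2, (length_tubeColor X₀ i).2 ht, (X i).ordered_universal _
        (by rw [universalTubes_toSimpleGraph]; rfl) (univ_notMem_tubes _), zero_add]
  · intro t hu ht
    obtain ⟨i, s, hs, rfl⟩ :=
      exists_ambient_eq_of_connected e (connected_induce_of_mem_universalTubes hu)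
    rw [ambient_mem_universalTubes hs] at hu
    subst hu
    rw [hT.supp_mem_iff] at ht
    rw [hlen i _ hs, hin i _ hs, (hT.core i _).1, (length_tubeColor X₀ i).2 ht,
      ← (X i).inner_universal _
        (by rw [universalTubes_toSimpleGraph]; rfl) (univ_notMem_tubes _), zero_add]
  · rw [hT.ncard_inter, ncard_universalTubes e, X₀.card_universalBlock, ncard_universalTubes_bot]
  · rw [finsum_ambient (e := e) (fun t => (b t).colors) (fun i s => ((X i).blocks s).colors)
      (fun i => ((X₀.blocks {i}).ordered : Multiset C)), add_assoc, sum_blocks_bot]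
    · simp_rw [Template.finsum_colors_eq]
      exact hP
    · intro i s hs hsu
      rw [hb i s hs, tubeColor_of_ne X₀ hsu, Blocks.prepend_nil]
    · intro i
      rw [hb i _ (component_univ_nonempty _), Blocks.colors_prepend, tubeColor, if_pos rfl]
    · intro i
      rw [blocks_empty_of_empty]
      rfl
    · intro t ht
      rw [hb₀ t ht]
      rfl

/-- The tube color is cut off from the blocks of every component that is a tube. The palettes of the
parts are not given in advance but read off as the sums of the colors that occur; counting core
nodes shows that they have the right sizes. -/
theorem exists_split (e : Fin m ≃ G.ConnectedComponent) (A : Template G P) :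
    ∃ (p : PalettePartition e P) (X : ∀ i, Template (e i).toSimpleGraph (p.part i))
      (X₀ : Template (⊥ : SimpleGraph (Fin m)) p.last), IsJoin A X X₀ := by
  classical
  obtain ⟨S, S₀, hT⟩ := exists_tubingSplit e A.tubing
  -- The number of tube colors, one or none, at the head of the blocks of the component.
  let k : Fin m → ℕ := fun i => if {i} ∈ S₀.tubes then 1 else 0
  let B : Fin m → Blocks C := fun i => A.blocks (ambient (e i) Set.univ)
  let b : ∀ i, Set (e i) → Blocks C := fun i s =>
    if s = Set.univ then ⟨(B i).ordered.drop (k i), (B i).inner⟩ else A.blocks (ambient (e i) s)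
  have hbu : ∀ i, b i Set.univ = ⟨(B i).ordered.drop (k i), (B i).inner⟩ := fun i => if_pos rfl
  have hbn : ∀ i (s : Set (e i)), s ≠ Set.univ → b i s = A.blocks (ambient (e i) s) :=
    fun i s hs => if_neg hs
  have huniv : ∀ i, ambient (e i) Set.univ ∈ universalTubes G := fun i =>
    (ambient_mem_universalTubes (component_univ_nonempty _)).2 rfl
  have hBo : ∀ i, (B i).ordered.length =
      k i + outerCount (e i).toSimpleGraph (S i).tubes Set.univ := by
    intro i
    rw [← (hT.core i _).2]
    by_cases hi : {i} ∈ S₀.tubes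
    · simp only [B, k, hi, if_true]
      exact A.ordered_tube _ ((hT.supp_mem_iff i).2 hi)
    · simp only [B, k, hi, if_false, zero_add]
      exact A.ordered_universal _ (huniv i) (fun h => hi ((hT.supp_mem_iff i).1 h))
  have hBi : ∀ i, (B i).ordered.length + (B i).inner.card + 1 =
      k i + (coreNodes (S i).tubes Set.univ).ncard := by
    intro i
    rw [← (hT.core i _).1]
    by_cases hi : {i} ∈ S₀.tubes
    · simp only [B, k, hi, if_true]
      rw [A.inner_tube _ ((hT.supp_mem_iff i).2 hi), add_comm]
    · simp only [B, k, hi, if_false, zero_add]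
      exact A.inner_universal _ (huniv i) (fun h => hi ((hT.supp_mem_iff i).1 h))
  have hbe : ∀ i (s : Set (e i)), s ∉ (S i).tubes → s ≠ Set.univ → b i s = ⟨[], 0⟩ := by
    intro i s hs hsu
    rw [hbn i s hsu]
    refine A.blocks_eq_empty _ (fun h => hs ((hT.mem_iff i s hsu).1 h)) fun h => ?_
    rcases s.eq_empty_or_nonempty with rfl | hne
    · have := (connected_induce_of_mem_universalTubes h).nonempty
      obtain ⟨v, hv⟩ := this
      exact Set.not_nonempty_empty (ambient_nonempty.1 ⟨v, hv⟩)
    · exact hsu ((ambient_mem_universalTubes hne).1 h)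
  have hbt : ∀ i, ∀ s ∈ (S i).tubes, (b i s).ordered.length = 1 + outerCount (e i).toSimpleGraph (S i).tubes s ∧
      (b i s).ordered.length + (b i s).inner.card = (coreNodes (S i).tubes s).ncard := by
    intro i s hs
    have hsu : s ≠ Set.univ := ((S i).isTube s hs).1
    rw [hbn i s hsu, ← (hT.core i _).1, ← (hT.core i _).2]
    exact ⟨A.ordered_tube _ ((hT.mem_iff i s hsu).2 hs), A.inner_tube _ ((hT.mem_iff i s hsu).2 hs)⟩
  have hbU : ∀ i, (b i Set.univ).ordered.length = outerCount (e i).toSimpleGraph (S i).tubes Set.univ ∧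
      (b i Set.univ).ordered.length + (b i Set.univ).inner.card + 1 =
        (coreNodes (S i).tubes Set.univ).ncard := by
    intro i
    have h₁ := hBo i
    have h₂ := hBi i
    rw [hbu]
    simp only [List.length_drop]
    omega
  let c : Fin m → List C := fun i => (B i).ordered.take (k i)
  have hc : ∀ i, (c i).length = k i := by
    intro i
    have h₁ := hBo i
    simp only [c, List.length_take]
    omega
  have hu0 : ∀ i, universalTubes (e i).toSimpleGraph = {Set.univ} := fun i =>
    universalTubes_toSimpleGraph _
  let X : ∀ i, Template (e i).toSimpleGraph (∑ᶠ s, (b i s).colors) := fun i =>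
    { tubing := S i
      blocks := b i
      universalBlock := 0
      blocks_eq_empty := fun s hs hu => hbe i s hs (by rwa [hu0] at hu)
      ordered_tube := fun s hs => (hbt i s hs).1
      inner_tube := fun s hs => (hbt i s hs).2
      ordered_universal := fun s hs _ => by
        rw [hu0, Set.mem_singleton_iff] at hs
        subst hs
        exact (hbU i).1
      inner_universal := fun s hs _ => by
        rw [hu0, Set.mem_singleton_iff] at hs
        subst hs
        exact (hbU i).2
      card_universalBlock := by
        rw [ncard_universalTubes_toSimpleGraph_inter, hu0, Set.ncard_singleton, Multiset.card_zero]
      partition := add_zero _ }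
  let b₀ : Set (Fin m) → Blocks C := fun t =>
    if h : ∃ i, t = {i} then ⟨c h.choose, 0⟩ else ⟨[], 0⟩
  have hb₀ : ∀ i, b₀ {i} = ⟨c i, 0⟩ := by
    intro i
    have h : ∃ j, ({i} : Set (Fin m)) = {j} := ⟨i, rfl⟩
    have hi : h.choose = i := (Set.singleton_injective h.choose_spec).symm
    have : b₀ {i} = ⟨c h.choose, 0⟩ := dif_pos h
    rw [this, hi]
  have hb₀e : ∀ t, (∀ i, t ≠ {i}) → b₀ t = ⟨[], 0⟩ := by
    intro t ht
    refine dif_neg ?_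
    rintro ⟨i, hi⟩
    exact ht i hi
  let X₀ : Template (⊥ : SimpleGraph (Fin m))
      (∑ i, (c i : Multiset C) + A.universalBlock) :=
    { tubing := S₀
      blocks := b₀
      universalBlock := A.universalBlock
      blocks_eq_empty := by
        intro t _ hu
        refine hb₀e t ?_
        rintro i rfl
        exact hu (singleton_mem_universalTubes_bot i)
      ordered_tube := by
        intro t ht
        obtain ⟨i, rfl⟩ := exists_eq_singleton_of_mem_tubes S₀ ht
        rw [hb₀, outerCount_bot, hc]
        simp [k, ht]
      inner_tube := by
        intro t ht
        obtain ⟨i, rfl⟩ := exists_eq_singleton_of_mem_tubes S₀ ht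
        rw [hb₀, coreNodes_bot, hc, Set.ncard_singleton]
        simp [k, ht]
      ordered_universal := by
        intro t hu ht
        rw [universalTubes_bot] at hu
        obtain ⟨i, rfl⟩ := hu
        rw [hb₀, outerCount_bot, hc]
        simp [k, ht]
      inner_universal := by
        intro t hu ht
        rw [universalTubes_bot] at hu
        obtain ⟨i, rfl⟩ := hu
        rw [hb₀, coreNodes_bot, hc, Set.ncard_singleton]
        simp [k, ht]
      card_universalBlock := by
        rw [← hT.ncard_inter, A.card_universalBlock, ncard_universalTubes_bot,
          ncard_universalTubes e]
      partition := by
        rw [finsum_eq_sum_singleton _ fun t ht => by rw [hb₀e t ht]; rfl]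
        simp_rw [hb₀]
        simp [Blocks.colors] }
  let p : PalettePartition e P :=
    { part := fun i => ∑ᶠ s, (b i s).colors
      last := ∑ i, (c i : Multiset C) + A.universalBlock
      card_part := by
        intro i
        have h := card_finsum_add (S i) (fun s => (b i s).colors)
          (fun s hs hu => by
            rw [hbe i s hs (by rwa [hu0] at hu)]
            rfl)
          (fun s hs => by
            rw [Blocks.colors, Multiset.card_add, Multiset.coe_card]
            exact (hbt i s hs).2)
          (fun s hs _ => by
            rw [hu0, Set.mem_singleton_iff] at hs
            subst hs
            rw [Blocks.colors, Multiset.card_add, Multiset.coe_card]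
            exact (hbU i).2)
        -- The single uncolored universal tube accounts for the difference of one between nodes and
        -- colors.
        have h₁ : ({Set.univ} : Set (Set (e i))) \ (S i).tubes = {Set.univ} := by
          rw [sdiff_eq_left, Set.disjoint_singleton_left]
          exact univ_notMem_tubes _
        rw [hu0, h₁, Set.ncard_singleton] at h
        rw [h]
        exact Nat.card_coe_set_eq _
      card_last := by
        have h := X₀.card_universalBlock
        have h₁ : ∑ i, k i = (S₀.tubes ∩ universalTubes (⊥ : SimpleGraph (Fin m))).ncard := by
          rw [ncard_tubes_inter_bot, Finset.sum_boole, Nat.cast_id, ← Set.ncard_coe_finset]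
          congr 1
          ext i
          simp
        rw [ncard_universalTubes_bot, ← h₁] at h
        rw [Multiset.card_add, Multiset.card_sum]
        simp_rw [Multiset.coe_card, hc]
        refine Eq.trans ?_ h
        change _ = A.universalBlock.card + _ + 1
        ring
      sum_eq := by
        have h := A.partition
        rw [finsum_ambient (e := e) (fun t => (A.blocks t).colors) (fun i s => (b i s).colors)
          (fun i => (c i : Multiset C)), add_assoc] at h
        · exact h
        · intro i s hs hsu
          rw [hbn i s hsu]
        · intro i
          rw [hbu]
          simp only [Blocks.colors]
          have : ((B i).ordered : Multiset C) =
              ((B i).ordered.take (k i) : Multiset C) + ((B i).ordered.drop (k i)) := by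
            rw [Multiset.coe_add, List.take_append_drop]
          change ((B i).ordered : Multiset C) + (B i).inner = _
          rw [this]
          simp only [c]
          abel
        · intro i
          rw [hbe i ∅ (fun h => Set.not_nonempty_empty ((S i).nonempty_of_mem h))
            (component_univ_nonempty _).ne_empty.symm]
          rfl
        · intro t ht
          rw [A.blocks_eq_empty t]
          · rfl
          · intro h
            obtain ⟨i, s, hs, rfl⟩ := exists_ambient_eq_of_connected e (A.tubing.isTube t h).2
            exact ht i s hs rfl
          · intro h
            obtain ⟨i, s, hs, rfl⟩ :=
              exists_ambient_eq_of_connected e (connected_induce_of_mem_universalTubes h)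
            exact ht i s hs rfl }
  refine ⟨p, X, X₀, hT, ?_, rfl⟩
  intro i s hs
  by_cases hsu : s = Set.univ
  · subst hsu
    change B i = (b i Set.univ).prepend _
    rw [hbu, tubeColor, if_pos rfl]
    change B i = Blocks.prepend (b₀ {i}).ordered _
    rw [hb₀]
    refine Blocks.ext ?_ rfl
    simp [Blocks.prepend, c]
  · rw [tubeColor_of_ne X₀ hsu, Blocks.prepend_nil]
    exact (hbn i s hsu).symm

end Join
-- Uniqueness of joins and of splittings
section Uniqueness

/-- Two templates, possibly with different palettes, with the same data. -/
structure SameData {W C : Type*} {H : SimpleGraph W} {P Q : Multiset C} (X : Template H P)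
    (Y : Template H Q) : Prop where
  tubing : X.tubing = Y.tubing
  blocks : X.blocks = Y.blocks
  universalBlock : X.universalBlock = Y.universalBlock

/-- The palette is the sum of all colors that occur. This lets parts be compared before their
palettes, and hence their types, are known to agree. -/
theorem SameData.palette_eq {W C : Type*} {H : SimpleGraph W} {P Q : Multiset C}
    {X : Template H P} {Y : Template H Q} (h : SameData X Y) : P = Q := by
  have h₁ := X.partition
  have h₂ := Y.partition
  rw [h.blocks, h.universalBlock] at h₁
  exact h₁.symm.trans h₂

theorem SameData.eq {W C : Type*} {H : SimpleGraph W} {P : Multiset C}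
    {X Y : Template H P} (h : SameData X Y) : X = Y :=
  Template.ext h.tubing h.blocks h.universalBlock

variable {V : Type*} {G : SimpleGraph V} {m : ℕ} {e : Fin m ≃ G.ConnectedComponent}
  {C : Type*} {P : Multiset C} {Q R : Fin m → Multiset C} {Q₀ R₀ : Multiset C}
  {A B : Template G P} {X : ∀ i, Template (e i).toSimpleGraph (Q i)}
  {Y : ∀ i, Template (e i).toSimpleGraph (R i)}
  {X₀ : Template (⊥ : SimpleGraph (Fin m)) Q₀} {Y₀ : Template (⊥ : SimpleGraph (Fin m)) R₀}

theorem IsJoin.sameData_component (hA : IsJoin A X X₀) (hB : IsJoin B Y Y₀) {i : Fin m}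
    (h₁ : ∀ s : Set (e i), s ≠ Set.univ →
      (ambient (e i) s ∈ A.tubing.tubes ↔ ambient (e i) s ∈ B.tubing.tubes))
    (h₂ : ∀ s : Set (e i), s.Nonempty → s ≠ Set.univ →
      A.blocks (ambient (e i) s) = B.blocks (ambient (e i) s))
    (h₃ : (X i).blocks Set.univ = (Y i).blocks Set.univ) : SameData (X i) (Y i) := by
  refine ⟨Tubing.ext (Set.ext fun s => ?_), funext fun s => ?_, ?_⟩
  · by_cases hs : s = Set.univ
    · subst hs
      exact iff_of_false (univ_notMem_tubes _) (univ_notMem_tubes _)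
    · rw [← hA.tubing.mem_iff i s hs, ← hB.tubing.mem_iff i s hs]
      exact h₁ s hs
  · by_cases hs : s = Set.univ
    · subst hs
      exact h₃
    · rcases s.eq_empty_or_nonempty with rfl | hne
      · rw [blocks_empty_of_empty, blocks_empty_of_empty]
      · have h := h₂ s hne hs
        rwa [hA.blocks i s hne, hB.blocks i s hne, tubeColor_of_ne X₀ hs, tubeColor_of_ne Y₀ hs]
          at h
  · rw [(X i).universalBlock_eq_zero, (Y i).universalBlock_eq_zero]

/-- Whether the component is a tube fixes the length of the tube color prefix, so the prefix can be
separated from the rest of the blocks. -/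
theorem IsJoin.blocks_univ (hA : IsJoin A X X₀) (hB : IsJoin B Y Y₀) {i : Fin m}
    (h₁ : {i} ∈ X₀.tubing.tubes ↔ {i} ∈ Y₀.tubing.tubes)
    (h₂ : A.blocks (ambient (e i) Set.univ) = B.blocks (ambient (e i) Set.univ)) :
    (X₀.blocks {i}).ordered = (Y₀.blocks {i}).ordered ∧
      (X i).blocks Set.univ = (Y i).blocks Set.univ := by
  have hne := component_univ_nonempty (e i)
  rw [hA.blocks i _ hne, hB.blocks i _ hne] at h₂
  have hlen : (tubeColor e X₀ i Set.univ).length = (tubeColor e Y₀ i Set.univ).length := by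
    by_cases h : {i} ∈ X₀.tubing.tubes
    · rw [(length_tubeColor X₀ i).1 h, (length_tubeColor Y₀ i).1 (h₁.1 h)]
    · rw [(length_tubeColor X₀ i).2 h, (length_tubeColor Y₀ i).2 (mt h₁.2 h)]
  obtain ⟨h₃, h₄⟩ := Blocks.prepend_inj h₂ hlen
  rw [tubeColor, tubeColor, if_pos rfl, if_pos rfl] at h₃
  exact ⟨h₃, h₄⟩

theorem sameData_bot (h₁ : ∀ i, {i} ∈ X₀.tubing.tubes ↔ {i} ∈ Y₀.tubing.tubes)
    (h₂ : ∀ i, (X₀.blocks {i}).ordered = (Y₀.blocks {i}).ordered)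
    (h₃ : X₀.universalBlock = Y₀.universalBlock) : SameData X₀ Y₀ := by
  refine ⟨Tubing.ext (Set.ext fun t => ?_), funext fun t => ?_, h₃⟩
  · constructor
    · intro ht
      obtain ⟨i, rfl⟩ := exists_eq_singleton_of_mem_tubes _ ht
      exact (h₁ i).1 ht
    · intro ht
      obtain ⟨i, rfl⟩ := exists_eq_singleton_of_mem_tubes _ ht
      exact (h₁ i).2 ht
  · by_cases ht : ∃ i, t = {i}
    · obtain ⟨i, rfl⟩ := ht
      exact Blocks.ext (h₂ i) (by rw [inner_blocks_bot, inner_blocks_bot])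
    · push Not at ht
      rw [blocks_bot_eq_empty X₀ ht, blocks_bot_eq_empty Y₀ ht]

theorem IsJoin.parts_unique (hA : IsJoin A X X₀) (hB : IsJoin A Y Y₀) :
    (∀ i, SameData (X i) (Y i)) ∧ SameData X₀ Y₀ := by
  have h : ∀ i, {i} ∈ X₀.tubing.tubes ↔ {i} ∈ Y₀.tubing.tubes := fun i => by
    rw [← hA.tubing.supp_mem_iff i, ← hB.tubing.supp_mem_iff i]
  exact ⟨fun i => hA.sameData_component hB (fun _ _ => Iff.rfl) (fun _ _ _ => rfl)
    (hA.blocks_univ hB (h i) rfl).2, sameData_bot h (fun i => (hA.blocks_univ hB (h i) rfl).1)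
      (hA.universalBlock.symm.trans hB.universalBlock)⟩

theorem blocks_eq_empty_of_forall_ambient_ne (A : Template G P) {t : Set V}
    (h : ∀ i (s : Set (e i)), s.Nonempty → ambient (e i) s ≠ t) : A.blocks t = ⟨[], 0⟩ := by
  refine A.blocks_eq_empty t (fun ht => ?_) fun ht => ?_
  · obtain ⟨i, s, hs, hst⟩ := exists_ambient_eq_of_connected e (A.tubing.isTube t ht).2
    exact h i s hs hst
  · obtain ⟨i, s, hs, hst⟩ :=
      exists_ambient_eq_of_connected e (connected_induce_of_mem_universalTubes ht)
    exact h i s hs hst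

theorem blocks_eq_of_ambient (e : Fin m ≃ G.ConnectedComponent) {t : Set V}
    (h : ∀ i (s : Set (e i)), s.Nonempty → ambient (e i) s = t → A.blocks t = B.blocks t) :
    A.blocks t = B.blocks t := by
  by_cases ht : ∃ i, ∃ s : Set (e i), s.Nonempty ∧ ambient (e i) s = t
  · obtain ⟨i, s, hs, hst⟩ := ht
    exact h i s hs hst
  · push Not at ht
    rw [blocks_eq_empty_of_forall_ambient_ne A ht, blocks_eq_empty_of_forall_ambient_ne B ht]

theorem tubes_eq_of_ambient (e : Fin m ≃ G.ConnectedComponent) {T U : Tubing G}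
    (h : ∀ i (s : Set (e i)), s.Nonempty →
      (ambient (e i) s ∈ T.tubes ↔ ambient (e i) s ∈ U.tubes)) : T = U := by
  refine Tubing.ext (Set.ext fun t => ?_)
  constructor
  · intro ht
    obtain ⟨i, s, hs, rfl⟩ := exists_ambient_eq_of_connected e (T.isTube t ht).2
    exact (h i s hs).1 ht
  · intro ht
    obtain ⟨i, s, hs, rfl⟩ := exists_ambient_eq_of_connected e (U.isTube t ht).2
    exact (h i s hs).2 ht

theorem tubes_eq_insert_of_ambient (e : Fin m ≃ G.ConnectedComponent) {T U : Tubing G}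
    {t : Set V} (ht : t ∈ T.tubes) (h : ∀ i (s : Set (e i)), s.Nonempty → ambient (e i) s ≠ t →
      (ambient (e i) s ∈ T.tubes ↔ ambient (e i) s ∈ U.tubes)) : T.tubes = insert t U.tubes := by
  ext u
  by_cases hut : u = t
  · subst hut
    simp [ht]
  rw [Set.mem_insert_iff, or_iff_right hut]
  constructor
  · intro hu
    obtain ⟨i, s, hs, rfl⟩ := exists_ambient_eq_of_connected e (T.isTube u hu).2
    exact (h i s hs hut).1 hu
  · intro hu
    obtain ⟨i, s, hs, rfl⟩ := exists_ambient_eq_of_connected e (U.isTube u hu).2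
    exact (h i s hs hut).2 hu

theorem IsJoin.unique (hA : IsJoin A X X₀) (hB : IsJoin B X X₀) : A = B := by
  refine Template.ext (tubes_eq_of_ambient e fun i s _ => ?_)
    (funext fun t => blocks_eq_of_ambient e ?_) (hA.universalBlock.trans hB.universalBlock.symm)
  · rw [hA.tubing.mem_tubes_iff, hB.tubing.mem_tubes_iff]
  · rintro i s hs rfl
    rw [hA.blocks i s hs, hB.blocks i s hs]

end Uniqueness

/-! ### Steps in `G` and steps in the factors -/

section Steps
variable {V : Type*} {G : SimpleGraph V} {m : ℕ} {e : Fin m ≃ G.ConnectedComponent}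

/-- All candidates contain the nonempty set `s`, so they lie in its component. -/
theorem IsTubingJoin.isLeast_iff {T : Tubing G} {S : ∀ i, Tubing (e i).toSimpleGraph}
    {S₀ : Tubing (⊥ : SimpleGraph (Fin m))} (h : IsTubingJoin T S S₀) {i : Fin m}
    {s r : Set (e i)} (hs : s.Nonempty) :
    IsLeast {u | (u ∈ T.tubes ∨ u ∈ universalTubes G) ∧ ambient (e i) s ⊂ u} (ambient (e i) r) ↔
      IsLeast {u | (u ∈ (S i).tubes ∨ u ∈ universalTubes (e i).toSimpleGraph) ∧ s ⊂ u} r := by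
  have hmem : ∀ u : Set (e i), ((ambient (e i) u ∈ T.tubes ∨
      ambient (e i) u ∈ universalTubes G) ∧ ambient (e i) s ⊂ ambient (e i) u) ↔
      (u ∈ (S i).tubes ∨ u ∈ universalTubes (e i).toSimpleGraph) ∧ s ⊂ u := by
    intro u
    rw [ambient_ssubset_ambient]
    exact and_congr_left fun hu => h.mem_all_iff (hs.mono hu.1)
  constructor
  · rintro ⟨h₁, h₂⟩
    exact ⟨(hmem r).1 h₁, fun u hu => ambient_subset_ambient.1 (h₂ ((hmem u).2 hu))⟩
  · rintro ⟨h₁, h₂⟩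
    refine ⟨(hmem r).2 h₁, ?_⟩
    rintro u ⟨hu, hsu⟩
    obtain ⟨j, u, hne, rfl⟩ := exists_ambient_eq_of_connected e (T.connected hu)
    obtain ⟨v, hv⟩ := ambient_nonempty.2 hs
    obtain rfl : i = j := e.injective (eq_of_mem_ambient hv (hsu.1 hv))
    exact ambient_subset_ambient.2 (h₂ ((hmem u).1 ⟨hu, hsu⟩))

variable {C : Type*} {P : Multiset C} {A B : Template G P}

section Same
variable {Q : Fin m → Multiset C} {Q₀ : Multiset C}
  {X Y : ∀ i, Template (e i).toSimpleGraph (Q i)}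
  {X₀ Y₀ : Template (⊥ : SimpleGraph (Fin m)) Q₀}

/-- If `r` is the whole component and has a tube color, this color precedes every linearization. So
it stays with `r`, and a splitting of the remaining colors in the component is a splitting in `G`.
-/
theorem IsJoin.addTube_component (hA : IsJoin A X X₀) (hB : IsJoin B Y X₀) {i : Fin m}
    (hXY : ∀ j, j ≠ i → X j = Y j) (h : AddTube (X i) (Y i)) : AddTube A B := by
  obtain ⟨s, hs, hins, h⟩ := h
  have hsX : s ∈ (X i).tubing.tubes := hins ▸ Or.inl rfl
  have hsu : s ≠ Set.univ := ((X i).tubing.isTube s hsX).1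
  have hsne : s.Nonempty := (X i).tubing.nonempty_of_mem hsX
  rcases h with ⟨hu, -⟩ | ⟨-, -, r, hr, hoth, w₁, w₂, h₁, h₂, h₃⟩
  · rw [universalTubes_toSimpleGraph] at hu
    exact (hsu hu).elim
  have hrne : r.Nonempty := hsne.mono hr.1.2.1
  refine ⟨ambient (e i) s, fun h => hs ((hB.tubing.mem_iff i s hsu).1 h),
    tubes_eq_insert_of_ambient e ((hA.tubing.mem_iff i s hsu).2 hsX) ?_, Or.inr
    ⟨fun h => hsu ((ambient_mem_universalTubes hsne).1 h), hA.universalBlock.trans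
      hB.universalBlock.symm, ambient (e i) r, (hB.tubing.isLeast_iff hsne).2 hr, ?_,
      tubeColor e X₀ i r ++ w₁, w₂, ?_, ?_, ?_⟩⟩
  · intro j u _ hne
    rw [hA.tubing.mem_tubes_iff, hB.tubing.mem_tubes_iff]
    by_cases hj : j = i
    · subst hj
      rw [hins, Set.mem_insert_iff, or_iff_right (fun h : u = s => hne (h ▸ rfl))]
    · rw [hXY j hj]
  · intro t hts htr
    refine blocks_eq_of_ambient e ?_
    rintro j u hu rfl
    rw [hA.blocks j u hu, hB.blocks j u hu]
    by_cases hj : j = i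
    · subst hj
      rw [hoth u (fun h => hts (h ▸ rfl)) (fun h => htr (h ▸ rfl))]
    · rw [hXY j hj]
  · rw [hA.blocks i r hrne]
    exact Blocks.isLinearization_prepend.2 ⟨w₁, h₁, rfl⟩
  · rw [hA.blocks i s hsne, tubeColor_of_ne X₀ hsu]
    exact h₂
  · rw [hB.blocks i r hrne]
    exact Blocks.isLinearization_prepend.2 ⟨_, h₃, List.append_assoc _ _ _⟩

/-- All tubes of a null graph are universal, so only the first kind of step occurs, and it takes the
color from the shared universal block. -/
theorem IsJoin.addTube_bot (hA : IsJoin A X X₀) (hB : IsJoin B X Y₀) (h : AddTube X₀ Y₀) :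
    AddTube A B := by
  obtain ⟨t, ht, hins, h⟩ := h
  have htX : t ∈ X₀.tubing.tubes := hins ▸ Or.inl rfl
  obtain ⟨i, rfl⟩ := exists_eq_singleton_of_mem_tubes _ htX
  have hne := component_univ_nonempty (e i)
  rcases h with ⟨-, hoth, c, hc, hc'⟩ | ⟨hu, -⟩
  · refine ⟨ambient (e i) Set.univ, fun h => ht ((hB.tubing.supp_mem_iff i).1 h),
      tubes_eq_insert_of_ambient e ((hA.tubing.supp_mem_iff i).2 htX) ?_, Or.inl
      ⟨(ambient_mem_universalTubes hne).2 rfl, ?_, c, ?_, ?_⟩⟩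
    · intro j s _ hs
      rw [hA.tubing.mem_tubes_iff, hB.tubing.mem_tubes_iff]
      refine or_congr_right (and_congr_right ?_)
      rintro rfl
      rw [hins, Set.mem_insert_iff, or_iff_right]
      rw [Set.singleton_eq_singleton_iff]
      rintro rfl
      exact hs rfl
    · intro t ht
      refine blocks_eq_of_ambient e ?_
      rintro j u hu rfl
      rw [hA.blocks j u hu, hB.blocks j u hu]
      congr 1
      unfold tubeColor
      split_ifs with huu
      · subst huu
        rw [hoth]
        rw [Ne, Set.singleton_eq_singleton_iff]
        rintro rfl
        exact ht rfl
      · rfl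
    · rw [hA.blocks i _ hne, hB.blocks i _ hne, tubeColor, tubeColor, if_pos rfl, if_pos rfl, hc]
      rfl
    · rw [hA.universalBlock, hB.universalBlock, hc']
  · exact (hu (singleton_mem_universalTubes_bot i)).elim

end Same

/-- The added tube concerns only one factor: the null graph if it is a component, and otherwise the
component around it. All other factors have the same data in `A` and `B`, hence the same palettes,
and the last palette class follows because the sum is fixed. Only after `p = q` is known can the
remaining factor be compared, and there the step is the given one. -/
theorem IsJoin.le_of_addTube {p q : PalettePartition e P}
    {X : ∀ i, Template (e i).toSimpleGraph (p.part i)}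
    {Y : ∀ i, Template (e i).toSimpleGraph (q.part i)}
    {X₀ : Template (⊥ : SimpleGraph (Fin m)) p.last}
    {Y₀ : Template (⊥ : SimpleGraph (Fin m)) q.last}
    (hA : IsJoin A X X₀) (hB : IsJoin B Y Y₀) (h : AddTube A B) :
    (⟨p, X, X₀⟩ : Σ p : PalettePartition e P, ComponentProduct e p.part p.last) ≤
      ⟨q, Y, Y₀⟩ := by
  obtain ⟨t, ht, hins, h⟩ := h
  have htA : t ∈ A.tubing.tubes := hins ▸ Or.inl rfl
  obtain ⟨i, s, hs, rfl⟩ := exists_ambient_eq_of_connected e (A.tubing.isTube t htA).2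
  have hmem : ∀ {u}, u ≠ ambient (e i) s → (u ∈ A.tubing.tubes ↔ u ∈ B.tubing.tubes) := by
    intro u hu
    rw [hins, Set.mem_insert_iff, or_iff_right hu]
  have hne : ∀ {j} {u : Set (e j)}, (⟨j, u⟩ : Σ i, Set (e i)) ≠ ⟨i, s⟩ →
      ambient (e j) u ≠ ambient (e i) s := by
    intro j u h h'
    exact h (ambient_sigma_eq hs h'.symm).symm
  rcases h with ⟨hu, hoth, c, hc, hc'⟩ | ⟨hu, hub, r, hr, hoth, w₁, w₂, h₁, h₂, h₃⟩
  · rw [ambient_mem_universalTubes hs] at hu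
    subst hu
    have htX := (hA.tubing.supp_mem_iff i).1 htA
    have htY := mt (hB.tubing.supp_mem_iff i).2 ht
    have hmem₀ : ∀ j, j ≠ i → ({j} ∈ X₀.tubing.tubes ↔ {j} ∈ Y₀.tubing.tubes) := by
      intro j hj
      rw [← hA.tubing.supp_mem_iff, ← hB.tubing.supp_mem_iff]
      exact hmem (hne fun h => hj (congrArg Sigma.fst h))
    have hYi : (Y₀.blocks {i}).ordered = [] :=
      List.length_eq_zero_iff.1 (length_blocks_bot_of_notMem Y₀ htY)
    -- As `{i}` is not yet colored in `Y₀`, the color `c` that was put in front is the whole tube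
    -- color prefix in `A`.
    have hsplit : (X₀.blocks {i}).ordered = [c] ∧
        (X i).blocks Set.univ = (Y i).blocks Set.univ := by
      rw [hA.blocks i _ hs, hB.blocks i _ hs, tubeColor, tubeColor, if_pos rfl, if_pos rfl,
        hYi] at hc
      exact Blocks.prepend_inj (l' := [c]) hc (length_blocks_bot_of_mem X₀ htX)
    have hsame : ∀ j, SameData (X j) (Y j) := by
      intro j
      refine hA.sameData_component hB (fun u hu => hmem (hne ?_)) (fun u _ hu => hoth _ (hne ?_)) ?_
      · rintro ⟨⟩
        exact hu rfl
      · rintro ⟨⟩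
        exact hu rfl
      · by_cases hj : j = i
        · subst hj
          exact hsplit.2
        · exact (hA.blocks_univ hB (hmem₀ j hj)
            (hoth _ (hne fun h => hj (congrArg Sigma.fst h)))).2
    have hpart : p.part = q.part := funext fun j => (hsame j).palette_eq
    have hpq : p = q := PalettePartition.ext hpart
      (add_left_cancel (p.sum_eq.trans (hpart ▸ q.sum_eq.symm)))
    subst hpq
    have hXY : X = Y := funext fun j => (hsame j).eq
    refine Sigma.mk_le_mk_iff.2 ⟨hXY.le, Relation.ReflTransGen.single
      ⟨{i}, htY, ?_, Or.inl ⟨singleton_mem_universalTubes_bot i, ?_, c, ?_, ?_⟩⟩⟩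
    · ext u
      rw [Set.mem_insert_iff]
      constructor
      · intro hu
        obtain ⟨j, rfl⟩ := exists_eq_singleton_of_mem_tubes _ hu
        by_cases hj : j = i
        · exact Or.inl (hj ▸ rfl)
        · exact Or.inr ((hmem₀ j hj).1 hu)
      · rintro (rfl | hu)
        · exact htX
        · obtain ⟨j, rfl⟩ := exists_eq_singleton_of_mem_tubes _ hu
          refine (hmem₀ j ?_).2 hu
          rintro rfl
          exact htY hu
    · intro u hu
      by_cases huj : ∃ j, u = {j}
      · obtain ⟨j, rfl⟩ := huj
        have hj : j ≠ i := fun h => hu (h ▸ rfl)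
        exact Blocks.ext (hA.blocks_univ hB (hmem₀ j hj)
            (hoth _ (hne fun h => hj (congrArg Sigma.fst h)))).1
          (by rw [inner_blocks_bot, inner_blocks_bot])
      · push Not at huj
        rw [blocks_bot_eq_empty X₀ huj, blocks_bot_eq_empty Y₀ huj]
    · exact Blocks.ext (by rw [hsplit.1, hYi]) (by rw [inner_blocks_bot, inner_blocks_bot])
    · rw [← hB.universalBlock, ← hA.universalBlock, hc']
  · have hsu : s ≠ Set.univ := fun h => hu ((ambient_mem_universalTubes hs).2 h)
    have htX := (hA.tubing.mem_iff i s hsu).1 htA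
    have htY := mt (hB.tubing.mem_iff i s hsu).2 ht
    obtain ⟨v, hv⟩ := ambient_nonempty.2 hs
    obtain ⟨j, r, hrne, rfl⟩ := exists_ambient_eq_of_connected e (B.tubing.connected hr.1.1)
    obtain rfl : i = j := e.injective (eq_of_mem_ambient hv (hr.1.2.1 hv))
    have hmem₀ : ∀ j, {j} ∈ X₀.tubing.tubes ↔ {j} ∈ Y₀.tubing.tubes := by
      intro j
      rw [← hA.tubing.supp_mem_iff, ← hB.tubing.supp_mem_iff]
      refine hmem (hne ?_)
      rintro ⟨⟩
      exact hsu rfl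
    have hoth' : ∀ j, j ≠ i → ∀ u : Set (e j),
        A.blocks (ambient (e j) u) = B.blocks (ambient (e j) u) := by
      intro j hj u
      rcases u.eq_empty_or_nonempty with rfl | hune
      · have : ambient (e j) ∅ = ∅ := Set.image_empty _
        rw [this, blocks_empty_of_empty, blocks_empty_of_empty]
      · exact hoth _ (hne fun h => hj (congrArg Sigma.fst h)) fun h =>
          hj (congrArg Sigma.fst (ambient_sigma_eq hune h))
    have hlin : ∀ w, (A.blocks (ambient (e i) r)).IsLinearization w ↔
        ∃ v, ((X i).blocks r).IsLinearization v ∧ w = tubeColor e X₀ i r ++ v := by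
      intro w
      rw [hA.blocks i r hrne, Blocks.isLinearization_prepend]
    have hlin' : ∀ w, (B.blocks (ambient (e i) r)).IsLinearization w ↔
        ∃ v, ((Y i).blocks r).IsLinearization v ∧ w = tubeColor e Y₀ i r ++ v := by
      intro w
      rw [hB.blocks i r hrne, Blocks.isLinearization_prepend]
    obtain ⟨v₁, hv₁, rfl⟩ := (hlin w₁).1 h₁
    obtain ⟨v₂, hv₂, hw⟩ := (hlin' _).1 h₃
    -- The added tube is not a component, so `r` has a tube color prefix in `A` exactly if it has
    -- one in `B`. Cutting it off on both sides leaves the splitting inside the component.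
    have hlen : (tubeColor e X₀ i r).length = (tubeColor e Y₀ i r).length := by
      by_cases hru : r = Set.univ
      · subst hru
        by_cases hi : {i} ∈ X₀.tubing.tubes
        · rw [(length_tubeColor X₀ i).1 hi, (length_tubeColor Y₀ i).1 ((hmem₀ i).1 hi)]
        · rw [(length_tubeColor X₀ i).2 hi, (length_tubeColor Y₀ i).2 (mt (hmem₀ i).2 hi)]
      · rw [tubeColor_of_ne X₀ hru, tubeColor_of_ne Y₀ hru]
    rw [List.append_assoc] at hw
    obtain ⟨hcol, rfl⟩ := List.append_inj hw hlen
    have hsame : ∀ j, j ≠ i → SameData (X j) (Y j) := by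
      intro j hj
      exact hA.sameData_component hB
        (fun u _ => hmem (hne fun h => hj (congrArg Sigma.fst h)))
        (fun u _ _ => hoth' j hj u) (hA.blocks_univ hB (hmem₀ j) (hoth' j hj _)).2
    have hother : ∀ u : Set (e i), u ≠ s → u ≠ r →
        A.blocks (ambient (e i) u) = B.blocks (ambient (e i) u) := fun u hus hur =>
      hoth _ (fun h => hus (ambient_injective h)) fun h => hur (ambient_injective h)
    have hsame₀ : SameData X₀ Y₀ := by
      refine sameData_bot hmem₀ (fun j => ?_) ?_
      · by_cases hj : j = i
        · subst hj
          by_cases hru : r = Set.univ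
          · subst hru
            rwa [tubeColor, tubeColor, if_pos rfl, if_pos rfl] at hcol
          · exact (hA.blocks_univ hB (hmem₀ j) (hother _ (Ne.symm hsu) (Ne.symm hru))).1
        · exact (hA.blocks_univ hB (hmem₀ j) (hoth' j hj _)).1
      · rw [← hA.universalBlock, ← hB.universalBlock, hub]
    have hlast : p.last = q.last := hsame₀.palette_eq
    have hpart : ∀ j, j ≠ i → p.part j = q.part j := fun j hj => (hsame j hj).palette_eq
    -- The step moves colors around inside this class; all other classes agree, so it is determined
    -- by cancellation.
    have hparti : p.part i = q.part i := by
      have h₁ := p.sum_eq.trans q.sum_eq.symm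
      rw [hlast, ← Finset.add_sum_erase _ _ (Finset.mem_univ i),
        ← Finset.add_sum_erase _ q.part (Finset.mem_univ i),
        Finset.sum_congr rfl fun j hj => hpart j (Finset.ne_of_mem_erase hj)] at h₁
      exact add_right_cancel (add_right_cancel h₁)
    have hpq : p = q := by
      refine PalettePartition.ext (funext fun j => ?_) hlast
      by_cases hj : j = i
      · exact hj ▸ hparti
      · exact hpart j hj
    subst hpq
    refine Sigma.mk_le_mk_iff.2 ⟨fun j => ?_, hsame₀.eq.le⟩
    by_cases hj : j = i
    · subst hj
      refine Relation.ReflTransGen.single ⟨s, htY, ?_, Or.inr ⟨?_, ?_, r,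
        (hB.tubing.isLeast_iff hs).1 hr, ?_, v₁, w₂, hv₁, ?_, hv₂⟩⟩
      · ext u
        rw [Set.mem_insert_iff]
        by_cases hus : u = s
        · subst hus
          simp [htX]
        rw [or_iff_right hus]
        by_cases huu : u = Set.univ
        · subst huu
          exact iff_of_false (univ_notMem_tubes _) (univ_notMem_tubes _)
        · exact (hA.tubing.mem_iff j u huu).symm.trans ((hmem fun h =>
            hus (ambient_injective h)).trans (hB.tubing.mem_iff j u huu))
      · rw [universalTubes_toSimpleGraph]
        exact hsu
      · rw [(X j).universalBlock_eq_zero, (Y j).universalBlock_eq_zero]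
      · intro u hus hur
        rcases u.eq_empty_or_nonempty with rfl | hune
        · rw [blocks_empty_of_empty, blocks_empty_of_empty]
        · have h := hother u hus hur
          by_cases huu : u = Set.univ
          · subst huu
            exact (hA.blocks_univ hB (hmem₀ j) h).2
          · rwa [hA.blocks j u hune, hB.blocks j u hune, tubeColor_of_ne X₀ huu,
              tubeColor_of_ne Y₀ huu] at h
      · rwa [hA.blocks j s hs, tubeColor_of_ne X₀ hsu] at h₂
    · exact (hsame j hj).eq.le

end Steps
-- The isomorphism with a disjoint union of products
section OrderIso
variable {V : Type*} [Finite V] {G : SimpleGraph V} {m : ℕ} {e : Fin m ≃ G.ConnectedComponent}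
  {C : Type*} {P : Multiset C}

/-- The template of `G` composed of templates of the components and of the null graph. -/
noncomputable def join (x : Σ p : PalettePartition e P, ComponentProduct e p.part p.last) :
    Template G P :=
  (exists_join x.2.1 x.2.2 x.1.sum_eq).choose

theorem isJoin_join (x : Σ p : PalettePartition e P, ComponentProduct e p.part p.last) :
    IsJoin (join x) x.2.1 x.2.2 :=
  (exists_join x.2.1 x.2.2 x.1.sum_eq).choose_spec

theorem join_bijective : Function.Bijective (join (e := e) (P := P)) := by
  constructor
  · rintro ⟨p, x, x₀⟩ ⟨q, y, y₀⟩ hxy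
    have hx := isJoin_join (⟨p, x, x₀⟩ : Σ p : PalettePartition e P, ComponentProduct e p.part p.last)
    have hy := isJoin_join (⟨q, y, y₀⟩ : Σ p : PalettePartition e P, ComponentProduct e p.part p.last)
    rw [← hxy] at hy
    obtain ⟨h, h₀⟩ := hx.parts_unique hy
    have hpq : p = q := PalettePartition.ext (funext fun i => (h i).palette_eq) h₀.palette_eq
    subst hpq
    have h₁ : x = y := funext fun i => (h i).eq
    have h₂ : x₀ = y₀ := h₀.eq
    rw [h₁, h₂]
  · intro A
    obtain ⟨p, x, x₀, h⟩ := exists_split e A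
    exact ⟨⟨p, x, x₀⟩, (isJoin_join _).unique h⟩

theorem join_mono_bot (p : PalettePartition e P)
    (x : ∀ i, Template (e i).toSimpleGraph (p.part i))
    {x₀ y₀ : Template (⊥ : SimpleGraph (Fin m)) p.last} (h : x₀ ≤ y₀) :
    join (⟨p, x, x₀⟩ : Σ p : PalettePartition e P, ComponentProduct e p.part p.last) ≤
      join ⟨p, x, y₀⟩ :=
  Relation.ReflTransGen.lift (r := AddTube) (p := AddTube)
    (fun z => join (⟨p, x, z⟩ : Σ p : PalettePartition e P, ComponentProduct e p.part p.last))
    (fun _ _ hz => IsJoin.addTube_bot (isJoin_join _) (isJoin_join _) hz) _ _ h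

theorem join_mono_component (p : PalettePartition e P)
    {x : ∀ i, Template (e i).toSimpleGraph (p.part i)} {i : Fin m}
    {a : Template (e i).toSimpleGraph (p.part i)}
    (x₀ : Template (⊥ : SimpleGraph (Fin m)) p.last) (h : x i ≤ a) :
    join (⟨p, x, x₀⟩ : Σ p : PalettePartition e P, ComponentProduct e p.part p.last) ≤
      join ⟨p, Function.update x i a, x₀⟩ := by
  have := Relation.ReflTransGen.lift (r := AddTube) (p := AddTube)
    (fun z => join (⟨p, Function.update x i z, x₀⟩ :
      Σ p : PalettePartition e P, ComponentProduct e p.part p.last))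
    (fun z w hz => IsJoin.addTube_component (i := i) (isJoin_join _) (isJoin_join _)
      (fun j hj => by simp [Function.update_of_ne hj]) (by simpa using hz)) _ _ h
  change join _ ≤ join _ at this
  rwa [Function.update_eq_self] at this

/-- The product order is reached by raising one coordinate at a time: first the components,
collected in a growing finite set, and then the null graph. -/
theorem join_mono (p : PalettePartition e P) {x y : ComponentProduct e p.part p.last}
    (h : x ≤ y) :
    join (⟨p, x⟩ : Σ p : PalettePartition e P, ComponentProduct e p.part p.last) ≤
      join ⟨p, y⟩ := by
  obtain ⟨x, x₀⟩ := x
  obtain ⟨y, y₀⟩ := y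
  refine le_trans ?_ (join_mono_bot p y h.2)
  have key : ∀ s : Finset (Fin m),
      join (⟨p, x, x₀⟩ : Σ p : PalettePartition e P, ComponentProduct e p.part p.last) ≤
        join ⟨p, s.piecewise y x, x₀⟩ := by
    intro s
    induction s using Finset.induction_on with
    | empty => simp
    | insert i s hi ih =>
      rw [Finset.piecewise_insert]
      refine ih.trans (join_mono_component p x₀ ?_)
      rw [Finset.piecewise_eq_of_notMem _ _ _ hi]
      exact h.1 i
  simpa using key Finset.univ

/-- A template is composed of templates of the components and of the null graph. -/
noncomputable def joinOrderIso :
    (Σ p : PalettePartition e P, ComponentProduct e p.part p.last) ≃o Template G P where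
  toEquiv := Equiv.ofBijective join join_bijective
  map_rel_iff' {x y} := by
    constructor
    · exact fun h => le_of_reflTransGen_map join_bijective
        (fun a b hab => (isJoin_join a).le_of_addTube (isJoin_join b) hab) h
    · intro h
      -- Comparable elements of the disjoint union lie in the same summand.
      obtain ⟨p, a, b, hab⟩ := h
      exact join_mono p hab

end OrderIso

/-! ### The simplex -/

/-- A tubing corresponds to the set of nodes that are not in it. This set is nonempty because not
all nodes occur, and adding tubes makes it smaller, as the order requires. -/
theorem nonempty_tubing_bot_orderIso (m : ℕ) :
    Nonempty (Tubing (⊥ : SimpleGraph (Fin m)) ≃o Simplex m) := by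
  refine ⟨{ toFun := fun T => ⟨{i | {i} ∉ T.tubes}, ?_⟩
            invFun := fun s =>
              { tubes := {t | ∃ i, i ∉ s.1 ∧ t = {i}}
                isTube := ?_
                compatible := ?_
                not_all := ?_ }
            left_inv := ?_
            right_inv := ?_
            map_rel_iff' := ?_ }⟩
  · by_contra h
    refine T.not_all ?_
    rw [universalTubes_bot]
    rintro _ ⟨i, rfl⟩
    by_contra hi
    exact h ⟨i, hi⟩
  · rintro _ ⟨i, hi, rfl⟩
    obtain ⟨j, hj⟩ := s.2
    refine isTube_bot_singleton fun h => hi ?_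
    have : j ∈ ({i} : Set (Fin m)) := h ▸ trivial
    rwa [Set.mem_singleton_iff.1 this] at hj
  · rintro _ ⟨i, -, rfl⟩ _ ⟨j, -, rfl⟩ hij
    refine Or.inr (Or.inr ⟨?_, fun x _ y _ h => h⟩)
    rw [Set.disjoint_singleton]
    rintro rfl
    exact hij rfl
  · intro h
    obtain ⟨j, hj⟩ := s.2
    obtain ⟨i, hi, hij⟩ := h (singleton_mem_universalTubes_bot j)
    rw [Set.singleton_eq_singleton_iff] at hij
    exact hi (hij ▸ hj)
  · intro T
    refine Tubing.ext (Set.ext fun t => ?_)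
    constructor
    · rintro ⟨i, hi, rfl⟩
      exact not_not.1 hi
    · intro ht
      obtain ⟨i, rfl⟩ := exists_eq_singleton_of_mem_tubes T ht
      exact ⟨i, not_not.2 ht, rfl⟩
  · intro s
    refine Subtype.ext (Set.ext fun i => ?_)
    constructor
    · intro h
      by_contra hi
      exact h ⟨i, hi, rfl⟩
    · rintro hi ⟨j, hj, hij⟩
      rw [Set.singleton_eq_singleton_iff] at hij
      exact hj (hij ▸ hi)
  · intro T U
    constructor
    · intro h t ht
      obtain ⟨i, rfl⟩ := exists_eq_singleton_of_mem_tubes U ht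
      by_contra hi
      exact h hi ht
    · intro h i hi hi'
      exact hi (h hi')

/-! ### Counting palette partitions -/

theorem sum_Iio_succ {m : ℕ} (c : Fin (m + 1) → ℕ) (i : Fin m) :
    ∑ j ∈ Finset.Iio i.succ, c j = c 0 + ∑ j ∈ Finset.Iio i, c j.succ := by
  have h : ∀ {k : ℕ} (a : Fin k) (f : Fin k → ℕ),
      ∑ j ∈ Finset.Iio a, f j = ∑ j, if j < a then f j else 0 := by
    intro k a f
    rw [← Finset.sum_filter]
    congr 1
    ext j
    simp
  rw [h, h, Fin.sum_univ_succ]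
  simp

/-- The first class is any submultiset of size `c 0`; as `S` has no repetitions there are a binomial
number of these, and the others partition the remainder. Finiteness is part of the induction because
the count of the dependent pairs needs finite fibers. -/
theorem card_multiset_partitions {C : Type*} {m : ℕ} (c : Fin m → ℕ) (S : Multiset C)
    (hS : S.Nodup) (hc : ∑ i, c i = S.card) :
    Finite {f : Fin m → Multiset C // (∀ i, (f i).card = c i) ∧ ∑ i, f i = S} ∧
    Nat.card {f : Fin m → Multiset C // (∀ i, (f i).card = c i) ∧ ∑ i, f i = S} =
      ∏ i, (S.card - ∑ j ∈ Finset.Iio i, c j).choose (c i) := by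
  classical
  induction m generalizing S with
  | zero =>
    have hS0 : S = 0 := by
      rw [← Multiset.card_eq_zero, ← hc]
      simp
    subst hS0
    have : Unique {f : Fin 0 → Multiset C // (∀ i, (f i).card = c i) ∧ ∑ i, f i = 0} :=
      { default := ⟨Fin.elim0, fun i => i.elim0, by simp⟩
        uniq := fun f => Subtype.ext (Subsingleton.elim _ _) }
    exact ⟨inferInstance, by rw [Nat.card_unique]; simp⟩
  | succ m ih =>
    let I := {s : Multiset C // s ∈ (Multiset.powersetCard (c 0) S).toFinset}
    have hI : ∀ s : I, s.1 ≤ S ∧ s.1.card = c 0 := fun s =>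
      Multiset.mem_powersetCard.1 (Multiset.mem_toFinset.1 s.2)
    rw [Fin.sum_univ_succ] at hc
    have hrest : ∀ s : I, ∑ i : Fin m, c i.succ = (S - s.1).card := by
      intro s
      rw [Multiset.card_sub (hI s).1, (hI s).2]
      omega
    have hih := fun s : I => ih (fun i => c i.succ) (S - s.1)
      (Multiset.nodup_of_le (Multiset.sub_le_self _ _) hS) (hrest s)
    let F : {f : Fin (m + 1) → Multiset C // (∀ i, (f i).card = c i) ∧ ∑ i, f i = S} ≃
        Σ s : I, {g : Fin m → Multiset C // (∀ i, (g i).card = c i.succ) ∧ ∑ i, g i = S - s.1} :=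
      { toFun := fun f => ⟨⟨f.1 0, by
            rw [Multiset.mem_toFinset, Multiset.mem_powersetCard]
            refine ⟨?_, f.2.1 0⟩
            have := f.2.2
            rw [Fin.sum_univ_succ] at this
            exact (Multiset.le_add_right _ _).trans_eq this⟩,
          fun i => f.1 i.succ, fun i => f.2.1 i.succ, by
            have := f.2.2
            rw [Fin.sum_univ_succ] at this
            exact (add_tsub_cancel_left (f.1 0) _).symm.trans
              (congrArg (· - f.1 0) this)⟩
        invFun := fun x => ⟨Fin.cons x.1.1 x.2.1, by
            intro i
            refine Fin.cases ?_ (fun j => ?_) i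
            · exact (hI x.1).2
            · exact x.2.2.1 j, by
            rw [Fin.sum_univ_succ]
            simp only [Fin.cons_zero, Fin.cons_succ]
            rw [x.2.2.2, add_comm, Multiset.sub_add_cancel (hI x.1).1]⟩
        left_inv := fun f => Subtype.ext (Fin.cons_self_tail f.1)
        right_inv := fun x => rfl }
    have hfin := fun s : I => (hih s).1
    refine ⟨Finite.of_equiv _ F.symm, ?_⟩
    rw [Nat.card_congr F, Nat.card_sigma, Fin.prod_univ_succ]
    have hconst : ∀ s : I, Nat.card {g : Fin m → Multiset C //
        (∀ i, (g i).card = c i.succ) ∧ ∑ i, g i = S - s.1} =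
        ∏ i : Fin m, (S.card - ∑ j ∈ Finset.Iio i.succ, c j).choose (c i.succ) := by
      intro s
      rw [(hih s).2]
      refine Finset.prod_congr rfl fun i _ => ?_
      rw [sum_Iio_succ, Multiset.card_sub (hI s).1, (hI s).2, Nat.sub_sub]
    rw [Finset.sum_congr rfl fun s _ => hconst s, Finset.sum_const, smul_eq_mul]
    congr 1
    rw [Finset.card_univ, Fintype.card_coe, Multiset.toFinset_card_of_nodup hS.powersetCard,
      Multiset.card_powersetCard]
    congr 1

section Count
variable {V : Type*} [Finite V] {G : SimpleGraph V} {m : ℕ} (e : Fin m ≃ G.ConnectedComponent)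
  {C : Type*} {P : Multiset C}

theorem sum_ncard_supp_sub_one :
    ∑ i, ((e i).supp.ncard - 1) + m = Nat.card V := by
  classical
  have := Fintype.ofFinite V
  have h : Nat.card V = ∑ i, (e i).supp.ncard := by
    rw [Nat.card_eq_fintype_card, ← Finset.card_univ, Finset.card_eq_sum_card_fiberwise
      (f := fun v => e.symm (G.connectedComponentMk v)) (t := Finset.univ) (fun _ _ => by simp)]
    refine Finset.sum_congr rfl fun i _ => ?_
    rw [← Set.ncard_coe_finset]
    congr 1
    ext v
    simp only [Finset.coe_filter, Finset.mem_univ, true_and, Set.mem_ofPred_eq,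
      Equiv.symm_apply_eq]
    rfl
  rw [h]
  have h1 : ∀ i, (e i).supp.ncard = ((e i).supp.ncard - 1) + 1 := fun i => by
    have := (Set.ncard_pos (Set.toFinite _)).2 (e i).nonempty_supp
    omega
  rw [Finset.sum_congr rfl fun i (_ : i ∈ Finset.univ) => h1 i, Finset.sum_add_distrib]
  simp

/-- The class of the null graph is chosen first, which gives the factor in front. After that
`Nat.card V - m` colors are left for the components. -/
theorem card_palettePartition [Nonempty V] (hP : P.card + 1 = Nat.card V) (hnd : P.Nodup) :
    Nat.card (PalettePartition e P) =
      (Nat.card V - 1).choose (m - 1) *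
        ∏ i : Fin m, (Nat.card V - m - ∑ j ∈ Finset.Iio i, ((e j).supp.ncard - 1)).choose
          ((e i).supp.ncard - 1) := by
  have hm : 1 ≤ m := by
    obtain ⟨v⟩ := ‹Nonempty V›
    have := (e.symm (G.connectedComponentMk v)).pos
    omega
  let c : Fin (m + 1) → ℕ := Fin.cons (m - 1) fun i => (e i).supp.ncard - 1
  have hpos : ∀ i, 1 ≤ (e i).supp.ncard := fun i =>
    (Set.ncard_pos (Set.toFinite _)).2 (e i).nonempty_supp
  let F : PalettePartition e P ≃
      {f : Fin (m + 1) → Multiset C // (∀ i, (f i).card = c i) ∧ ∑ i, f i = P} :=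
    { toFun := fun p => ⟨Fin.cons p.last p.part, by
          intro i
          refine Fin.cases ?_ (fun j => ?_) i
          · have := p.card_last
            simp only [Fin.cons_zero, c]
            omega
          · have := p.card_part j
            simp only [Fin.cons_succ, c]
            omega, by
          rw [Fin.sum_univ_succ]
          simp only [Fin.cons_zero, Fin.cons_succ]
          rw [add_comm, p.sum_eq]⟩
      invFun := fun f =>
        { part := fun i => f.1 i.succ
          last := f.1 0
          card_part := fun i => by
            have := hpos i
            rw [f.2.1 i.succ]
            simp only [Fin.cons_succ, c]
            omega
          card_last := by
            rw [f.2.1 0]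
            simp only [Fin.cons_zero, c]
            omega
          sum_eq := by
            rw [add_comm, ← Fin.sum_univ_succ, f.2.2] }
      left_inv := fun p => rfl
      right_inv := fun f => Subtype.ext (Fin.cons_self_tail f.1) }
  have hsum := sum_ncard_supp_sub_one e
  rw [Nat.card_congr F, (card_multiset_partitions c P hnd (by
    rw [Fin.sum_univ_succ]
    simp only [Fin.cons_zero, Fin.cons_succ, c]
    omega)).2, Fin.prod_univ_succ]
  have h0 : Finset.Iio (0 : Fin (m + 1)) = ∅ := by
    ext j
    simp
  have hPc : P.card = Nat.card V - 1 := by omega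
  congr 1
  · rw [h0, Finset.sum_empty, hPc]
    rfl
  · refine Finset.prod_congr rfl fun i _ => ?_
    rw [sum_Iio_succ, hPc]
    simp only [Fin.cons_zero, Fin.cons_succ, c]
    congr 1
    omega

end Count

/-- A product of order isomorphisms. -/
def prodOrderIso {ι : Type*} {α α' : ι → Type*} {β β' : Type*} [∀ i, Preorder (α i)]
    [∀ i, Preorder (α' i)] [Preorder β] [Preorder β'] (φ : ∀ i, α i ≃o α' i) (ψ : β ≃o β') :
    (∀ i, α i) × β ≃o (∀ i, α' i) × β' where
  toEquiv := (Equiv.piCongrRight fun i => (φ i).toEquiv).prodCongr ψ.toEquiv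
  map_rel_iff' {_ _} := and_congr (forall_congr' fun i => (φ i).le_iff_le) ψ.le_iff_le

/-! ### The monochrome and the full case -/

theorem eq_of_le_monochrome {C : Type*} {P s t : Multiset C}
    (hP : ∀ x ∈ P, ∀ y ∈ P, x = y) (hs : s ≤ P) (ht : t ≤ P) (h : s.card = t.card) : s = t := by
  rcases P.empty_or_exists_mem with rfl | ⟨a, ha⟩
  · rw [Multiset.le_zero.1 hs, Multiset.le_zero.1 ht]
  · rw [Multiset.eq_replicate_of_mem fun x hx => hP x (Multiset.mem_of_le hs hx) a ha,
      Multiset.eq_replicate_of_mem fun x hx => hP x (Multiset.mem_of_le ht hx) a ha, h]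

section PalettePartition
variable {V : Type*} {G : SimpleGraph V} {m : ℕ} {e : Fin m ≃ G.ConnectedComponent}
  {C : Type*} {P : Multiset C}

theorem PalettePartition.part_le (p : PalettePartition e P) (i : Fin m) : p.part i ≤ P :=
  (Finset.single_le_sum (f := p.part) (fun _ _ => Multiset.zero_le _) (Finset.mem_univ i)).trans
    ((Multiset.le_add_right _ _).trans_eq p.sum_eq)

theorem PalettePartition.last_le (p : PalettePartition e P) : p.last ≤ P :=
  (Multiset.le_add_left _ _).trans_eq p.sum_eq

/-- The class sizes are prescribed, and with one color the sizes are everything. -/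
theorem PalettePartition.eq_of_monochrome (hP : ∀ x ∈ P, ∀ y ∈ P, x = y)
    (p q : PalettePartition e P) : p = q := by
  refine PalettePartition.ext (funext fun i => ?_) ?_
  · have h₁ := p.card_part i
    have h₂ := q.card_part i
    exact eq_of_le_monochrome hP (p.part_le i) (q.part_le i) (by omega)
  · have h₁ := p.card_last
    have h₂ := q.card_last
    exact eq_of_le_monochrome hP p.last_le q.last_le (by omega)

end PalettePartition

/-- The disjoint union has exactly one summand, and every factor of it again has a monochrome
palette, so it is a poset of tubings. -/
theorem nonempty_orderIso_of_monochrome {V : Type*} [Finite V] [Nonempty V] (G : SimpleGraph V)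
    (m : ℕ) (e : Fin m ≃ G.ConnectedComponent) {C : Type*} (P : Multiset C)
    (hcard : P.card + 1 = Nat.card V) (hP : ∀ x ∈ P, ∀ y ∈ P, x = y) :
    Nonempty (Template G P ≃o (∀ i, Tubing (e i).toSimpleGraph) × Simplex m) := by
  obtain ⟨φ⟩ := nonempty_orderIso_tubing (G := G) hP hcard
  -- Splitting the template on the empty tubing shows that a palette partition exists.
  let T : Tubing G :=
    { tubes := ∅
      isTube := fun _ h => h.elim
      compatible := Set.pairwise_empty _
      not_all := by
        obtain ⟨v⟩ := ‹Nonempty V›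
        exact fun h => h (supp_mem_universalTubes (G.connectedComponentMk v)) }
  obtain ⟨p, -, -, -⟩ := exists_split e (φ.symm T)
  let ψ : ComponentProduct e p.part p.last ≃o
      Σ p : PalettePartition e P, ComponentProduct e p.part p.last :=
    { toEquiv := Equiv.ofBijective
        (fun x => (⟨p, x⟩ : Σ p : PalettePartition e P, ComponentProduct e p.part p.last)) ⟨fun _ _ h => eq_of_heq (Sigma.mk.inj h).2, by
        rintro ⟨q, x⟩
        obtain rfl := PalettePartition.eq_of_monochrome hP p q
        exact ⟨x, rfl⟩⟩
      map_rel_iff' := Sigma.mk_le_mk_iff }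
  have hpart : ∀ i, Nonempty (Template (e i).toSimpleGraph (p.part i) ≃o
      Tubing (e i).toSimpleGraph) := fun i =>
    nonempty_orderIso_tubing (fun x hx y hy => hP x (Multiset.mem_of_le (p.part_le i) hx) y
      (Multiset.mem_of_le (p.part_le i) hy)) ((p.card_part i).trans (Nat.card_coe_set_eq _).symm)
  obtain ⟨φ₀⟩ : Nonempty (Template (⊥ : SimpleGraph (Fin m)) p.last ≃o
      Tubing (⊥ : SimpleGraph (Fin m))) :=
    nonempty_orderIso_tubing (fun x hx y hy => hP x (Multiset.mem_of_le p.last_le hx) y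
      (Multiset.mem_of_le p.last_le hy)) (by rw [p.card_last, Nat.card_fin])
  obtain ⟨σ⟩ := nonempty_tubing_bot_orderIso m
  let φi := fun i => (hpart i).some
  exact ⟨joinOrderIso.symm.trans (ψ.symm.trans
    (prodOrderIso φi (φ₀.trans σ)))⟩

/-- Classes of a full palette are full, and the posets of a factor for two full palettes of equal
size differ by a renaming of colors. -/
theorem nonempty_componentProduct_orderIso {V : Type*} [Finite V] {G : SimpleGraph V} {m : ℕ}
    {e : Fin m ≃ G.ConnectedComponent} {C : Type*} {P : Multiset C} (hP : P.Nodup)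
    (p : PalettePartition e P) {D : Type*} (Q : Fin m → Multiset D) (Q₀ : Multiset D)
    (hQ : ∀ i, (Q i).Nodup ∧ (Q i).card + 1 = (e i).supp.ncard)
    (hQ₀ : Q₀.Nodup ∧ Q₀.card + 1 = m) :
    Nonempty (ComponentProduct e p.part p.last ≃o ComponentProduct e Q Q₀) := by
  have h : ∀ i, Nonempty (Template (e i).toSimpleGraph (p.part i) ≃o
      Template (e i).toSimpleGraph (Q i)) := fun i => Template.nonempty_orderIso_of_nodup (G := (e i).toSimpleGraph)
    (Multiset.nodup_of_le (p.part_le i) hP) (hQ i).1 (by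
      have h₁ := p.card_part i
      have h₂ := (hQ i).2
      omega)
  let φ := fun i => (h i).some
  obtain ⟨φ₀⟩ := Template.nonempty_orderIso_of_nodup (G := (⊥ : SimpleGraph (Fin m)))
    (Multiset.nodup_of_le p.last_le hP) hQ₀.1 (by
      have h₁ := p.card_last
      have h₂ := hQ₀.2
      omega)
  exact ⟨prodOrderIso φ φ₀⟩

end ColorfulAssoc

theorem corollary5p4 {V : Type*} [Finite V] [Nonempty V] (G : SimpleGraph V)
    (m : ℕ) (e : Fin m ≃ G.ConnectedComponent)
    {C : Type*} (P : Multiset C) (hP : P.card + 1 = Nat.card V) :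
    -- monochrome palette
    ((∀ x ∈ P, ∀ y ∈ P, x = y) →
      Nonempty (Template G P ≃o (∀ i, Tubing (e i).toSimpleGraph) × Simplex m)) ∧
    -- full palette
    (P.Nodup →
      -- the colorful graph associahedron is the disjoint union, over all ordered partitions of the
      -- palette, of the corresponding products
      Nonempty (Template G P ≃o
        (Σ p : PalettePartition e P, ComponentProduct e p.part p.last)) ∧
      -- the number of copies
      Nat.card (PalettePartition e P) =
        (Nat.card V - 1).choose (m - 1) *
          ∏ i : Fin m, (Nat.card V - m - ∑ j ∈ Finset.Iio i, ((e j).supp.ncard - 1)).choose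
            ((e i).supp.ncard - 1) ∧
      -- the copies are identical: each is the product for arbitrary full palettes of the factors
      (∀ (p : PalettePartition e P) {D : Type*} (Q : Fin m → Multiset D) (Q₀ : Multiset D),
        (∀ i, (Q i).Nodup ∧ (Q i).card + 1 = (e i).supp.ncard) →
        (Q₀.Nodup ∧ Q₀.card + 1 = m) →
        Nonempty (ComponentProduct e p.part p.last ≃o ComponentProduct e Q Q₀)) ∧
      -- all members of the collection (one below each template of the empty tubing) are identical
      (∀ A B : Template G P, A.tubing.tubes = ∅ → B.tubing.tubes = ∅ →
        Nonempty (Set.Iic A ≃o Set.Iic B))) := by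
  refine ⟨nonempty_orderIso_of_monochrome G m e P hP, fun hnd => ⟨⟨joinOrderIso.symm⟩,
    card_palettePartition e hP hnd, fun p _ Q Q₀ hQ hQ₀ =>
      nonempty_componentProduct_orderIso hnd p Q Q₀ hQ hQ₀, fun A B hA hB =>
      nonempty_Iic_orderIso hnd A B (Tubing.ext (hA.trans hB.symm))⟩⟩
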